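/- **Model.** Let $\beta_1^*,\beta_2^*\in\mathbb R^k$ be unit vectors with $\beta_1^*\neq\pm\beta_2^*$ (so $k\ge 2$), and let $p_1,p_2>0$ with $p_1+p_2=1$. Let $(x_i,z_i)$, $i=1,\dots,N$, be i.i.d. with $x_i\sim\mathcal N(0,I_k)$ and labels $z_i\in\{0,1\}$ independent of $x_i$, $\mathbb P(z_i=1)=p_1$; the noiseless responses are $y_i=z_i\langle x_i,\beta_1^*\rangle+(1-z_i)\langle x_i,\beta_2^*\rangle$. **Algorithm (initialization with resampling).** Input: grid resolution $\delta>0$ and the samples $(y_i,x_i)$, whose indices are partitioned into two fixed disjoint sets $\mathcal S_*,\mathcal S_+$. Let $v_1,v_2$ be orthonormal top two eigenvectors of $M=\frac1{|\mathcal S_*|}\sum_{i\in\mathcal S_*}y_i^2\,x_ix_i^\top$, and let $G=\{v_1\cos(\delta t)+v_2\sin(\delta t): t=0,1,\dots,\lceil 2\pi/\delta\rceil\}$. Output a pair $(\beta_1^{(0)},\beta_2^{(0)})\in G\times G$ that minimizes over $G\times G$ the loss $$\mathcal L_+(u_1,u_2)=\sum_{i\in\mathcal S_+}\min\{(y_i-\langle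 x_i,u_1\rangle)^2,\,(y_i-\langle x_i,u_2\rangle)^2\}.$$ Ties between eigenvectors or between minimizers may be broken in any way. Since $\mathcal L_+$ is symmetric, the output is an unordered pair, and its error is measured up to a swap of its two members: $$err^{(0)}=\min_{\pi\in S_2}\ \max_{b=1,2}\ \|\beta^{(0)}_{\pi(b)}-\beta_b^*\|_2 .$$ **Proposition.** For every $\hat c\in(0,1/2)$ and every value of $\min\{p_1,p_2\}>0$ there are constants $c_1,c_2,c_3>0$, depending only on $\hat c$ and $\min\{p_1,p_2\}$ (in particular not on $k$, $\beta_1^*$, $\beta_2^*$, $\delta$ or $N$), such that the following holds. If $$0<\delta\le \tfrac{2}{11}\,\hat c\,\|\beta_1^*-\beta_2^*\|_2\,\sqrt{\min\{p_1,p_2\}}^{\,3},$$ $$|\mathcal S_*|\ \ge\ c_1\Big(\frac1{\tilde\delta}\Big)^2 k\log^2 k,\qquad |\mathcal S_+|\ \ge\ \frac{c_2}{\min\{p_1,p_2\}}\,k,$$ where $$\tilde\delta=\frac{\delta^2}{384}\Big(1-\sqrt{1-4\,(1-\langle\beta_1^*,\beta_2^*\rangle^2)\,p_1p_2}\Big),$$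 then with probability at least $1-c_3k^{-2}$ the algorithm has an output, and every possible output satisfies $$err^{(0)}\ \le\ \hat c\,\min\{p_1,p_2\}\,\|\beta_1^*-\beta_2^*\|_2 .$$ -/

import Mathlib

open MeasureTheory ProbabilityTheory

namespace MixedRegression

/-- The space `ℝ^k` with its Euclidean norm. -/
abbrev Vec (k : ℕ) : Type := EuclideanSpace ℝ (Fin k)

/-- The random design of mixed linear regression: the pairs `(x_i, z_i)` are mutually independent,
`x_i ∼ N(0, I_k)`, the label `z_i` is independent of `x_i`, and it picks the first regressor
(`z_i = true`) with probability `p₁`. -/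
structure IsMixedDesign {k N : ℕ} {Ω : Type*} [MeasurableSpace Ω] (μ : Measure Ω) (p₁ : ℝ)
    (x : Fin N → Ω → Vec k) (z : Fin N → Ω → Bool) : Prop where
  measurable_x : ∀ i, Measurable (x i)
  measurable_z : ∀ i, Measurable (z i)
  law_x : ∀ i, μ.map (x i) = stdGaussian (Vec k)
  prob_z : ∀ i, μ.real {ω | z i ω = true} = p₁
  indep_x_z : ∀ i, IndepFun (x i) (z i) μ
  indep : iIndepFun (fun i ω => (x i ω, z i ω)) μ

/-- The noiseless response `⟨x, β₁⟩ z + ⟨x, β₂⟩ (1 - z)`. -/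
noncomputable def response {k : ℕ} (β₁ β₂ x : Vec k) (z : Bool) : ℝ :=
  if z then inner ℝ x β₁ else inner ℝ x β₂

/-- The operator `M = |S|⁻¹ ∑_{i ∈ S} y_i² x_i ⊗ x_i`. -/
noncomputable def momentOp {k N : ℕ} (S : Finset (Fin N)) (x : Fin N → Vec k) (y : Fin N → ℝ) :
    Vec k →L[ℝ] Vec k :=
  (S.card : ℝ)⁻¹ • ∑ i ∈ S, (y i ^ 2) • InnerProductSpace.rankOne ℝ (x i) (x i)

/-- `v₁, v₂` is a valid choice of top two (orthonormal) eigenvectors of the symmetric operator `M`: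
their eigenvalues satisfy `l₁ ≥ l₂`, and `l₂` is at least every eigenvalue of `M` that has an
eigenvector orthogonal to both. -/
def IsTopTwo {k : ℕ} (M : Vec k →L[ℝ] Vec k) (v₁ v₂ : Vec k) : Prop :=
  ‖v₁‖ = 1 ∧ ‖v₂‖ = 1 ∧ inner ℝ v₁ v₂ = 0 ∧
    ∃ l₁ l₂ : ℝ, M v₁ = l₁ • v₁ ∧ M v₂ = l₂ • v₂ ∧ l₂ ≤ l₁ ∧
      ∀ (w : Vec k) (l : ℝ), w ≠ 0 → inner ℝ v₁ w = 0 → inner ℝ v₂ w = 0 →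
        M w = l • w → l ≤ l₂

/-- The grid of resolution `δ` on the unit circle of the plane spanned by `v₁, v₂`. -/
def grid {k : ℕ} (δ : ℝ) (v₁ v₂ : Vec k) : Set (Vec k) :=
  {u | ∃ t : ℕ, t ≤ ⌈2 * Real.pi / δ⌉₊ ∧ u = Real.cos (δ * t) • v₁ + Real.sin (δ * t) • v₂}

/-- The empirical loss `∑_{i ∈ S} min_{z ∈ {0,1}} (y_i - ⟨x_i, z u₁ + (1 - z) u₂⟩)²`. -/
noncomputable def loss {k N : ℕ} (S : Finset (Fin N)) (x : Fin N → Vec k) (y : Fin N → ℝ)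
    (u₁ u₂ : Vec k) : ℝ :=
  ∑ i ∈ S, min ((y i - inner ℝ (x i) u₁) ^ 2) ((y i - inner ℝ (x i) u₂) ^ 2)

/-- `(b₁, b₂)` is a possible output of the initialization with resampling, run with grid resolution
`δ` on the samples `(x_i, y_i)` split into `Sstar` (eigenspace) and `Splus` (loss). The relation
allows every choice of top eigenvectors and every choice of a minimizing grid pair. -/
def IsInitOutput {k N : ℕ} (δ : ℝ) (Sstar Splus : Finset (Fin N))
    (x : Fin N → Vec k) (y : Fin N → ℝ) (b₁ b₂ : Vec k) : Prop :=
  ∃ v₁ v₂ : Vec k, IsTopTwo (momentOp Sstar x y) v₁ v₂ ∧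
    b₁ ∈ grid δ v₁ v₂ ∧ b₂ ∈ grid δ v₁ v₂ ∧
    ∀ u₁ ∈ grid δ v₁ v₂, ∀ u₂ ∈ grid δ v₁ v₂, loss Splus x y b₁ b₂ ≤ loss Splus x y u₁ u₂

/-- The error `max {‖b₁ - β₁‖, ‖b₂ - β₂‖}`. -/
noncomputable def err {k : ℕ} (β₁ β₂ b₁ b₂ : Vec k) : ℝ :=
  max ‖b₁ - β₁‖ ‖b₂ - β₂‖

/-- `(δ² / 384) (1 - √(1 - 4 (1 - ⟨β₁, β₂⟩²) p₁ p₂))`. -/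
noncomputable def deltaTilde {k : ℕ} (δ p₁ p₂ : ℝ) (β₁ β₂ : Vec k) : ℝ :=
  δ ^ 2 / 384 * (1 - Real.sqrt (1 - 4 * (1 - (inner ℝ β₁ β₂ : ℝ) ^ 2) * p₁ * p₂))

end MixedRegression

namespace MixedRegression

/-! ### Moments and exponential moments of one-dimensional projections of a Gaussian vector. -/

section Gaussian

/-! For unit vectors `E[⟨x,a⟩²⟨x,w⟩²] = 1 + 2⟨a,w⟩²`, so the moment operator `M` has mean `I + 2(p₁
β₁β₁ᵀ + p₂ β₂β₂ᵀ)`. Write `p` for the smaller weight.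

Plane. Suppose the quadratic form of `M` is within `e` of its mean on the sphere. By a min-max
comparison the form is at most `1 + e` on the complement of the top two eigenvectors. The component
`w` of `β_b` in that complement satisfies `⟨β_b,w⟩ = ‖w‖²`, so the form at `w` is at least `(1 -
e)‖w‖² + 2p‖w‖⁴`, whence `p‖w‖² ≤ e` (`IsTopTwo.mul_norm_sub_proj_sq_le`). No eigenvalue gap is
needed; `deltaTilde` enters only through `0 < deltaTilde ≤ δ²`. With `e = pδ²/20000`, normalising
the projection and rounding its angle give grid points within `δ/100 + δ/2` of `β₁` and `β₂`.

Loss. On the second sample the empirical second moments are at most `2|S|`, so the good grid pair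
has loss at most `4|S|(51δ/100)²`. Within each class, sums of `min(⟨x,a⟩², ⟨x,a'⟩²)` over unit `a,
a'` are at least `(24/625)p|S|`, so a pair whose two members both miss `β_b` by `m` has loss at
least `(24/625)p|S|m²`. Comparing the two bounds for a minimizer controls `m`
(`min_err_le_of_loss_le`), and the separation of `β₁, β₂` forces a matching.

Concentration. All bounds are proved on a net of the sphere by Chernoff and union bounds, then
extended to all directions. The products `⟨x,a⟩²⟨x,w⟩²` can lack exponential moments, so for the
upper tail the squared response is truncated at a multiple of `log n`; the lower tail needs no
truncation (`IsMixedDesign.exists_event_moment`). -/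

lemma integrable_exp_mul_sq_gaussianReal {s : ℝ} (hs : s < 1 / 2) :
    Integrable (fun t : ℝ => Real.exp (s * t ^ 2)) (gaussianReal 0 1) := by
  rw [gaussianReal_of_var_ne_zero 0 one_ne_zero,
    integrable_withDensity_iff (measurable_gaussianPDF 0 1)
      (ae_of_all _ fun _ => gaussianPDF_lt_top)]
  have h : (fun t : ℝ => Real.exp (s * t ^ 2) * (gaussianPDF 0 1 t).toReal)
      = fun t => (Real.sqrt (2 * Real.pi))⁻¹ * Real.exp (-(1 / 2 - s) * t ^ 2) := by
    funext t
    rw [toReal_gaussianPDF, gaussianPDFReal]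
    simp only [NNReal.coe_one, mul_one, sub_zero]
    rw [mul_left_comm, ← Real.exp_add]
    ring_nf
  rw [h]
  exact (integrable_exp_neg_mul_sq (by linarith)).const_mul _

lemma integral_exp_mul_sq_gaussianReal {s : ℝ} (hs : s < 1 / 2) :
    ∫ t, Real.exp (s * t ^ 2) ∂(gaussianReal 0 1) = (Real.sqrt (1 - 2 * s))⁻¹ := by
  rw [integral_gaussianReal_eq_integral_smul one_ne_zero]
  have h : (fun t : ℝ => gaussianPDFReal 0 1 t • Real.exp (s * t ^ 2))
      = fun t => (Real.sqrt (2 * Real.pi))⁻¹ * Real.exp (-(1 / 2 - s) * t ^ 2) := by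
    funext t
    rw [gaussianPDFReal]
    simp only [NNReal.coe_one, mul_one, sub_zero, smul_eq_mul]
    rw [mul_assoc, ← Real.exp_add]
    ring_nf
  rw [h, integral_const_mul, integral_gaussian, ← Real.sqrt_inv, ← Real.sqrt_inv,
    ← Real.sqrt_mul (by positivity)]
  congr 1
  have h1 : (1 : ℝ) / 2 - s ≠ 0 := by linarith
  have h2 : (1 : ℝ) - 2 * s ≠ 0 := by linarith
  have h3 := Real.pi_ne_zero
  field_simp

lemma integral_pow_four_gaussianReal : ∫ t, t ^ 4 ∂(gaussianReal 0 1) = 3 := by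
  have h := iteratedDeriv_mgf_zero (X := id) (μ := gaussianReal 0 1)
    (by simp [integrableExpSet_id_gaussianReal]) 4
  have hm : mgf id (gaussianReal 0 1) = fun t => Real.exp (t ^ 2 / 2) := by
    rw [mgf_id_gaussianReal]; simp
  have hE : ∀ t : ℝ, HasDerivAt (fun t : ℝ => Real.exp (t ^ 2 / 2)) (t * Real.exp (t ^ 2 / 2)) t := by
    intro t
    have := ((hasDerivAt_pow 2 t).div_const 2).exp
    convert this using 1
    simp; ring
  have d1 : deriv (fun t : ℝ => Real.exp (t ^ 2 / 2)) = fun t => t * Real.exp (t ^ 2 / 2) :=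
    funext fun t => (hE t).deriv
  have d2 : deriv (fun t : ℝ => t * Real.exp (t ^ 2 / 2))
      = fun t => (1 + t ^ 2) * Real.exp (t ^ 2 / 2) := by
    funext t
    rw [((hasDerivAt_id' t).fun_mul (hE t)).deriv]
    simp; ring
  have d3 : deriv (fun t : ℝ => (1 + t ^ 2) * Real.exp (t ^ 2 / 2))
      = fun t => (3 * t + t ^ 3) * Real.exp (t ^ 2 / 2) := by
    funext t
    rw [(((hasDerivAt_pow 2 t).const_add 1).fun_mul (hE t)).deriv]
    simp; ring
  have d4 : deriv (fun t : ℝ => (3 * t + t ^ 3) * Real.exp (t ^ 2 / 2))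
      = fun t => (3 + 6 * t ^ 2 + t ^ 4) * Real.exp (t ^ 2 / 2) := by
    funext t
    rw [((((hasDerivAt_id' t).const_mul 3).fun_add (hasDerivAt_pow 3 t)).fun_mul (hE t)).deriv]
    simp; ring
  rw [hm, iteratedDeriv_succ, iteratedDeriv_succ, iteratedDeriv_succ, iteratedDeriv_one,
    d1, d2, d3, d4] at h
  simpa using h.symm

variable {k : ℕ}

lemma map_inner_stdGaussian {u : Vec k} (hu : ‖u‖ = 1) :
    (stdGaussian (Vec k)).map (fun x => inner ℝ x u) = gaussianReal 0 1 := by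
  have h := IsGaussian.map_eq_gaussianReal (μ := stdGaussian (Vec k)) (innerSL ℝ u)
  rw [integral_strongDual_stdGaussian, variance_dual_stdGaussian, innerSL_apply_norm, hu] at h
  have e : (fun x : Vec k => (inner ℝ x u : ℝ)) = innerSL ℝ u := by
    funext x; simp [real_inner_comm]
  rw [e, h]; simp

lemma measurable_inner_right (u : Vec k) : Measurable fun x : Vec k => (inner ℝ x u : ℝ) := by
  fun_prop

lemma integrable_exp_mul_inner_sq {u : Vec k} (hu : ‖u‖ = 1) {s : ℝ} (hs : s < 1 / 2) :
    Integrable (fun x : Vec k => Real.exp (s * (inner ℝ x u) ^ 2)) (stdGaussian (Vec k)) := by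
  have h := integrable_exp_mul_sq_gaussianReal hs
  rw [← map_inner_stdGaussian hu] at h
  exact h.comp_measurable (measurable_inner_right u)

lemma integral_exp_mul_inner_sq {u : Vec k} (hu : ‖u‖ = 1) {s : ℝ} (hs : s < 1 / 2) :
    ∫ x, Real.exp (s * (inner ℝ x u) ^ 2) ∂(stdGaussian (Vec k)) = (Real.sqrt (1 - 2 * s))⁻¹ := by
  rw [← integral_exp_mul_sq_gaussianReal hs, ← map_inner_stdGaussian hu,
    integral_map (measurable_inner_right u).aemeasurable (by fun_prop)]

/-- From `u²/2 ≤ exp u` at `u = t²/16`; the constant is `2 · 16²`. -/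
lemma pow_four_le_exp (t : ℝ) : t ^ 4 ≤ 512 * Real.exp (1 / 16 * t ^ 2) := by
  have h := Real.quadratic_le_exp_of_nonneg (x := 1 / 16 * t ^ 2) (by positivity)
  nlinarith [sq_nonneg t]

lemma integrable_inner_pow_four (w : Vec k) :
    Integrable (fun x : Vec k => (inner ℝ x w : ℝ) ^ 4) (stdGaussian (Vec k)) := by
  rcases eq_or_ne w 0 with rfl | hw
  · simp
  have hu : ‖(‖w‖⁻¹ • w)‖ = 1 := by simp [norm_smul, hw]
  refine ((integrable_exp_mul_inner_sq hu (s := 1 / 16) (by norm_num)).const_mul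
    (512 * ‖w‖ ^ 4)).mono' (by fun_prop) (ae_of_all _ fun x => ?_)
  have := pow_four_le_exp (inner ℝ x (‖w‖⁻¹ • w))
  rw [Real.norm_of_nonneg (by positivity)]
  have e : (inner ℝ x w : ℝ) = ‖w‖ * inner ℝ x (‖w‖⁻¹ • w) := by
    rw [inner_smul_right, ← mul_assoc, mul_inv_cancel₀ (by simpa using hw), one_mul]
  rw [e, mul_pow]
  nlinarith [pow_nonneg (norm_nonneg w) 4]

lemma integral_inner_pow_four (w : Vec k) :
    ∫ x, (inner ℝ x w : ℝ) ^ 4 ∂(stdGaussian (Vec k)) = 3 * ‖w‖ ^ 4 := by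
  rcases eq_or_ne w 0 with rfl | hw
  · simp
  have hu : ‖(‖w‖⁻¹ • w)‖ = 1 := by simp [norm_smul, hw]
  have e : ∀ x : Vec k, (inner ℝ x w : ℝ) ^ 4 = ‖w‖ ^ 4 * (inner ℝ x (‖w‖⁻¹ • w)) ^ 4 := by
    intro x
    rw [← mul_pow, inner_smul_right, ← mul_assoc, mul_inv_cancel₀ (by simpa using hw), one_mul]
  simp_rw [e]
  rw [integral_const_mul, mul_comm]
  congr 1
  rw [← integral_pow_four_gaussianReal, ← map_inner_stdGaussian hu,
    integral_map (measurable_inner_right _).aemeasurable (by fun_prop)]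

/-- Polarisation reduces mixed fourth moments to fourth powers of a single projection, so the joint
law of two projections is never needed. -/
lemma inner_sq_mul_inner_sq_eq (a b x : Vec k) :
    (inner ℝ x a : ℝ) ^ 2 * (inner ℝ x b) ^ 2 =
      ((inner ℝ x (a + b)) ^ 4 + (inner ℝ x (a - b)) ^ 4
        - 2 * (inner ℝ x a) ^ 4 - 2 * (inner ℝ x b) ^ 4) / 12 := by
  rw [inner_add_right, inner_sub_right]; ring

lemma integrable_inner_sq_mul_inner_sq (a b : Vec k) :
    Integrable (fun x : Vec k => (inner ℝ x a : ℝ) ^ 2 * (inner ℝ x b) ^ 2)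
      (stdGaussian (Vec k)) := by
  simp_rw [inner_sq_mul_inner_sq_eq]
  exact ((((integrable_inner_pow_four _).add (integrable_inner_pow_four _)).sub
    ((integrable_inner_pow_four _).const_mul 2)).sub
    ((integrable_inner_pow_four _).const_mul 2)).div_const 12

lemma integral_inner_sq_mul_inner_sq {a b : Vec k} (ha : ‖a‖ = 1) (hb : ‖b‖ = 1) :
    ∫ x, (inner ℝ x a : ℝ) ^ 2 * (inner ℝ x b) ^ 2 ∂(stdGaussian (Vec k))
      = 1 + 2 * (inner ℝ a b) ^ 2 := by
  have I := integrable_inner_pow_four (k := k)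
  simp_rw [inner_sq_mul_inner_sq_eq]
  have I₂ : Integrable (fun x : Vec k => (inner ℝ x (a + b) : ℝ) ^ 4 + (inner ℝ x (a - b)) ^ 4)
      (stdGaussian (Vec k)) := (I _).add (I _)
  have I₃ : Integrable (fun x : Vec k => (inner ℝ x (a + b) : ℝ) ^ 4 + (inner ℝ x (a - b)) ^ 4
      - 2 * (inner ℝ x a) ^ 4) (stdGaussian (Vec k)) := I₂.sub ((I _).const_mul 2)
  rw [integral_div, integral_sub I₃ ((I _).const_mul 2), integral_sub I₂ ((I _).const_mul 2),
    integral_add (I _) (I _),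
    integral_const_mul, integral_const_mul]
  simp only [integral_inner_pow_four]
  have h1 := norm_add_sq_real a b
  have h2 := norm_sub_sq_real a b
  rw [show ‖a + b‖ ^ 4 = (‖a + b‖ ^ 2) ^ 2 by ring, show ‖a - b‖ ^ 4 = (‖a - b‖ ^ 2) ^ 2 by ring,
    h1, h2, ha, hb]
  ring

end Gaussian

/-! ### Nets of the unit sphere and operator norms. -/

section Net

variable {k : ℕ}

/-- Volume comparison: the balls of radius `η/2` about the points are disjoint and lie in the ball
of radius `1 + η/2`. -/
lemma card_le_of_separated_sphere {η : ℝ} (hη : 0 < η) (s : Finset (Vec k))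
    (hs : ∀ c ∈ s, ‖c‖ = 1) (h : ∀ c ∈ s, ∀ d ∈ s, c ≠ d → η ≤ ‖c - d‖) :
    (s.card : ℝ) ≤ (1 + 2 / η) ^ k := by
  let vol : Measure (Vec k) := Measure.addHaar
  have hη2 : 0 < η / 2 := by positivity
  have hρ : 0 < 1 + η / 2 := by positivity
  have D : Set.Pairwise (s : Set (Vec k))
      (Function.onFun Disjoint fun c => Metric.ball c (η / 2)) := by
    rintro c hc d hd hcd
    apply Metric.ball_disjoint_ball
    rw [dist_eq_norm]
    linarith [h c hc d hd hcd]
  have hsub : (⋃ c ∈ s, Metric.ball c (η / 2)) ⊆ Metric.ball (0 : Vec k) (1 + η / 2) := by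
    refine Set.iUnion₂_subset fun c hc => Metric.ball_subset_ball' ?_
    rw [dist_zero_right, hs c hc, add_comm]
  have I := measure_mono (μ := vol) hsub
  rw [measure_biUnion_finset D fun c _ => measurableSet_ball] at I
  simp only [vol.addHaar_ball_of_pos _ hη2, vol.addHaar_ball_of_pos _ hρ, Finset.sum_const,
    nsmul_eq_mul, ← mul_assoc, finrank_euclideanSpace, Fintype.card_fin] at I
  have J := (ENNReal.mul_le_mul_iff_left (Metric.measure_ball_pos vol _ zero_lt_one).ne'
    measure_ball_lt_top.ne).1 I
  have K := ENNReal.toReal_le_of_le_ofReal (by positivity) J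
  rw [ENNReal.toReal_mul, ENNReal.toReal_natCast, ENNReal.toReal_ofReal (by positivity)] at K
  rw [← le_div_iff₀ (by positivity), ← div_pow] at K
  have e : 1 + 2 / η = (1 + η / 2) / (η / 2) := by
    field_simp
    ring
  rwa [e]

/-- The unit sphere has an `η`-net of at most `(1 + 2 / η) ^ k` unit vectors. -/
lemma exists_sphere_net (k : ℕ) {η : ℝ} (hη : 0 < η) :
    ∃ T : Finset (Vec k), (∀ t ∈ T, ‖t‖ = 1) ∧ (T.card : ℝ) ≤ (1 + 2 / η) ^ k ∧
      ∀ u : Vec k, ‖u‖ = 1 → ∃ t ∈ T, ‖u - t‖ ≤ η := by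
  classical
  let P : Finset (Vec k) → Prop := fun s =>
    (∀ c ∈ s, ‖c‖ = 1) ∧ ∀ c ∈ s, ∀ d ∈ s, c ≠ d → η ≤ ‖c - d‖
  -- A separated set of maximal cardinality is a net, since a point far from all its members could
  -- be added to it.
  let A : Set ℕ := {n | ∃ s, P s ∧ s.card = n}
  have hA : BddAbove A := by
    refine ⟨⌊(1 + 2 / η) ^ k⌋₊, ?_⟩
    rintro n ⟨s, hs, rfl⟩
    exact Nat.le_floor (card_le_of_separated_sphere hη s hs.1 hs.2)
  have hne : A.Nonempty := ⟨0, ∅, by simp [P], rfl⟩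
  obtain ⟨T, hT, hcard⟩ := Nat.sSup_mem hne hA
  refine ⟨T, hT.1, card_le_of_separated_sphere hη T hT.1 hT.2, fun u hu => ?_⟩
  by_contra! hcon
  have huT : u ∉ T := fun hmem => by
    have := hcon u hmem
    simp at this
    linarith
  have hP : P (insert u T) := by
    refine ⟨?_, ?_⟩
    · simp only [Finset.mem_insert, forall_eq_or_imp]
      exact ⟨hu, hT.1⟩
    · intro c hc d hd hcd
      rw [Finset.mem_insert] at hc hd
      rcases hc with rfl | hc <;> rcases hd with rfl | hd
      · exact absurd rfl hcd
      · exact (hcon d hd).le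
      · rw [norm_sub_rev]; exact (hcon c hc).le
      · exact hT.2 c hc d hd hcd
  have := le_csSup hA (show (insert u T).card ∈ A from ⟨_, hP, rfl⟩)
  rw [Finset.card_insert_of_notMem huT] at this
  omega

/-- A symmetric operator whose quadratic form is small on a net of the sphere has small norm. -/
lemma norm_le_of_net {D : Vec k →L[ℝ] Vec k} (hD : D.IsSymmetric) {T : Finset (Vec k)} {η s : ℝ}
    (hη : η < 1 / 2) (hT : ∀ t ∈ T, ‖t‖ = 1) (hnet : ∀ u : Vec k, ‖u‖ = 1 → ∃ t ∈ T, ‖u - t‖ ≤ η)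
    (hs : 0 ≤ s) (h : ∀ t ∈ T, |inner ℝ (D t) t| ≤ s) : ‖D‖ ≤ s / (1 - 2 * η) := by
  -- A self-bounding inequality: moving to the nearest net point costs a multiple of `‖D‖` itself,
  -- absorbed at the end because `2η < 1`.
  have key : ‖D‖ ≤ s + 2 * η * ‖D‖ := by
    rcases isEmpty_or_nonempty (Fin k) with hk | hk
    · have : D = 0 := by ext x i; exact hk.elim i
      simp [this, hs]
    have hη0 : 0 ≤ η := by
      obtain ⟨t, -, ht⟩ := hnet (EuclideanSpace.single (Classical.arbitrary _) 1) (by simp)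
      exact (norm_nonneg _).trans ht
    have unit : ∀ u : Vec k, ‖u‖ = 1 → |inner ℝ (D u) u| ≤ s + 2 * η * ‖D‖ := by
      intro u hu
      obtain ⟨t, ht, hut⟩ := hnet u hu
      have hsymm : inner ℝ (D u) t = inner ℝ (D t) u := by
        rw [real_inner_comm]; exact (hD t u).symm
      have e : inner ℝ (D u) u = inner ℝ (D t) t + inner ℝ (D (u - t)) (u + t) := by
        rw [map_sub, inner_sub_left, inner_add_right, inner_add_right, hsymm]
        ring
      have b1 : |inner ℝ (D (u - t)) (u + t)| ≤ ‖D‖ * η * 2 := by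
        refine (abs_real_inner_le_norm _ _).trans (mul_le_mul ?_ ?_ (norm_nonneg _) (by positivity))
        · exact (D.le_opNorm _).trans (by gcongr)
        · exact (norm_add_le _ _).trans (by rw [hu, hT t ht]; norm_num)
      rw [e]
      exact (abs_add_le _ _).trans (by linarith [h t ht])
    rw [D.norm_eq_iSup_rayleighQuotient hD]
    refine ciSup_le fun x => ?_
    rw [← D.norm_eq_iSup_rayleighQuotient hD]
    rcases eq_or_ne x 0 with rfl | hx
    · simp; positivity
    have hx' : ‖x‖⁻¹ ≠ 0 := by simpa using hx
    rw [← D.rayleigh_smul x hx', ContinuousLinearMap.rayleighQuotient]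
    have hu : ‖(‖x‖⁻¹ • x)‖ = 1 := by simp [norm_smul, hx]
    rw [hu]
    simpa [ContinuousLinearMap.reApplyInnerSelf] using unit _ hu
  rw [le_div_iff₀ (by linarith)]
  linarith

end Net

/-! ### Existence and variational property of the top two eigenvectors. -/

section TopTwo

variable {k : ℕ}

/-- The Rayleigh quotient attains its maximum on the compact unit sphere of `W`, and a maximizer is
an eigenvector of the restriction of `M` to `W`. -/
lemma exists_max_eigenvector {M : Vec k →L[ℝ] Vec k} (hM : M.IsSymmetric)
    (W : Submodule ℝ (Vec k)) (hW : ∀ w ∈ W, M w ∈ W) (hne : W ≠ ⊥) :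
    ∃ v ∈ W, ‖v‖ = 1 ∧ ∃ l : ℝ, M v = l • v ∧ ∀ w ∈ W, inner ℝ (M w) w ≤ l * ‖w‖ ^ 2 := by
  have : Nontrivial W := Submodule.nontrivial_iff_ne_bot.2 hne
  let T₀ : W →ₗ[ℝ] W := (M : Vec k →ₗ[ℝ] Vec k).restrict hW
  have hT₀ : T₀.IsSymmetric := fun x y => hM x y
  let T := hT₀.toSelfAdjoint
  obtain ⟨x₁, hx₁⟩ := exists_norm_eq W (zero_le_one : (0 : ℝ) ≤ 1)
  obtain ⟨x₀, hx₀, hmax⟩ := (isCompact_sphere (0 : W) 1).exists_isMaxOn ⟨x₁, by simpa using hx₁⟩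
    T.val.reApplyInnerSelf_continuous.continuousOn
  have hx₀' : ‖x₀‖ = 1 := by simpa using hx₀
  have hx₀_ne : x₀ ≠ 0 := by rintro rfl; simp at hx₀'
  have heig := T.prop.hasEigenvector_of_isMaxOn hx₀_ne (by rwa [hx₀'])
  set l : ℝ := ⨆ x : { x : W // x ≠ 0 }, T.val.rayleighQuotient x with hl
  have hMx : M x₀ = l • (x₀ : Vec k) :=
    congrArg (fun w : W => (w : Vec k)) heig.apply_eq_smul
  have hnorm : ‖(x₀ : Vec k)‖ = 1 := by simpa using hx₀'
  have hval : inner ℝ (M x₀) (x₀ : Vec k) = l := by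
    rw [hMx, inner_smul_left, real_inner_self_eq_norm_sq, hnorm]; simp
  refine ⟨x₀, x₀.2, hnorm, l, hMx, fun w hw => ?_⟩
  rcases eq_or_ne w 0 with rfl | hw0
  · simp
  have hwn : ‖w‖ ≠ 0 := by simpa using hw0
  have hmem : (‖w‖⁻¹ • (⟨w, hw⟩ : W)) ∈ Metric.sphere (0 : W) 1 := by
    simp [norm_smul, hwn]
  have := hmax hmem
  have h2 : inner ℝ (M (‖w‖⁻¹ • w)) (‖w‖⁻¹ • w) ≤ inner ℝ (M x₀) (x₀ : Vec k) := this
  rw [hval, map_smul, inner_smul_left, inner_smul_right] at h2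
  simp only [conj_trivial] at h2
  have h3 : 0 < ‖w‖ ^ 2 := by positivity
  rw [← div_le_iff₀ h3]
  calc _ = ‖w‖⁻¹ * (‖w‖⁻¹ * inner ℝ (M w) w) := by field_simp
    _ ≤ l := h2

lemma mem_orthogonal_pair {v₁ v₂ w : Vec k} :
    w ∈ (Submodule.span ℝ {v₁, v₂})ᗮ ↔ inner ℝ v₁ w = 0 ∧ inner ℝ v₂ w = 0 := by
  rw [Submodule.mem_orthogonal]
  constructor
  · intro h
    exact ⟨h _ (Submodule.subset_span (by simp)), h _ (Submodule.subset_span (by simp))⟩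
  · rintro ⟨h1, h2⟩ u hu
    obtain ⟨a, b, rfl⟩ := Submodule.mem_span_pair.1 hu
    simp [inner_add_left, inner_smul_left, h1, h2]

lemma orthogonal_pair_invariant {M : Vec k →L[ℝ] Vec k} (hM : M.IsSymmetric) {v₁ v₂ : Vec k}
    {l₁ l₂ : ℝ} (h₁ : M v₁ = l₁ • v₁) (h₂ : M v₂ = l₂ • v₂) :
    ∀ w ∈ (Submodule.span ℝ {v₁, v₂})ᗮ, M w ∈ (Submodule.span ℝ {v₁, v₂})ᗮ := by
  intro w hw
  rw [mem_orthogonal_pair] at hw ⊢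
  have s1 : inner ℝ v₁ (M w) = inner ℝ (M v₁) w := (hM v₁ w).symm
  have s2 : inner ℝ v₂ (M w) = inner ℝ (M v₂) w := (hM v₂ w).symm
  rw [s1, s2, h₁, h₂, inner_smul_left, inner_smul_left, hw.1, hw.2]
  simp

lemma exists_isTopTwo {M : Vec k →L[ℝ] Vec k} (hM : M.IsSymmetric) (hk : 2 ≤ k) :
    ∃ v₁ v₂, IsTopTwo M v₁ v₂ := by
  have hfr : Module.finrank ℝ (Vec k) = k := by simp
  have htop : (⊤ : Submodule ℝ (Vec k)) ≠ ⊥ := by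
    intro h
    have := congrArg (fun W : Submodule ℝ (Vec k) => Module.finrank ℝ W) h
    simp at this
    omega
  obtain ⟨v₁, -, hv₁, l₁, hl₁, hmax₁⟩ := exists_max_eigenvector hM ⊤ (by simp) htop
  -- Deflation by the first eigenvector; it is repeated so that the lemmas on pairs apply.
  let W := (Submodule.span ℝ {v₁, v₁})ᗮ
  have hW : W ≠ ⊥ := by
    intro h
    have h1 := Submodule.finrank_add_finrank_orthogonal (Submodule.span ℝ {v₁, v₁})
    change Module.finrank ℝ _ + Module.finrank ℝ W = _ at h1
    rw [h, hfr, finrank_bot] at h1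
    have h2 := finrank_span_le_card (R := ℝ) ({v₁, v₁} : Set (Vec k))
    simp at h2 h1
    omega
  obtain ⟨v₂, hv₂W, hv₂, l₂, hl₂, hmax₂⟩ :=
    exists_max_eigenvector hM W (orthogonal_pair_invariant hM hl₁ hl₁) hW
  refine ⟨v₁, v₂, hv₁, hv₂, (mem_orthogonal_pair.1 hv₂W).1, l₁, l₂, hl₁, hl₂, ?_, ?_⟩
  · have := hmax₁ v₂ trivial
    rwa [hl₂, inner_smul_left, real_inner_self_eq_norm_sq, hv₂, conj_trivial, one_pow, mul_one,
      mul_one] at this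
  · intro w l hw hw1 _ hMw
    have := hmax₂ w (mem_orthogonal_pair.2 ⟨hw1, hw1⟩)
    rw [hMw, inner_smul_left, real_inner_self_eq_norm_sq, conj_trivial] at this
    have : 0 < ‖w‖ ^ 2 := by positivity
    nlinarith

/-- The quadratic form on the orthogonal complement of the top two eigenvectors is at most its
supremum on the complement of any two vectors. -/
lemma IsTopTwo.form_le {M : Vec k →L[ℝ] Vec k} (hM : M.IsSymmetric) {v₁ v₂ : Vec k}
    (hv : IsTopTwo M v₁ v₂) {β₁ β₂ : Vec k} {a : ℝ}
    (h : ∀ w, inner ℝ β₁ w = 0 → inner ℝ β₂ w = 0 → inner ℝ (M w) w ≤ a * ‖w‖ ^ 2)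
    {w : Vec k} (hw₁ : inner ℝ v₁ w = 0) (hw₂ : inner ℝ v₂ w = 0) :
    inner ℝ (M w) w ≤ a * ‖w‖ ^ 2 := by
  obtain ⟨hv₁, hv₂, hv₁₂, l₁, l₂, hl₁, hl₂, hl, htop⟩ := hv
  rcases eq_or_ne w 0 with rfl | hw0
  · simp
  have hwW : w ∈ (Submodule.span ℝ {v₁, v₂})ᗮ := mem_orthogonal_pair.2 ⟨hw₁, hw₂⟩
  obtain ⟨e, heW, he, l, hle, hmax⟩ := exists_max_eigenvector hM _
    (orthogonal_pair_invariant hM hl₁ hl₂) (fun hbot => hw0 (by rw [hbot] at hwW; simpa using hwW))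
  obtain ⟨he₁, he₂⟩ := mem_orthogonal_pair.1 heW
  have hll : l ≤ l₂ := htop e l (by rintro rfl; simp at he) he₁ he₂ hle
  suffices hla : l ≤ a from (hmax w hwW).trans (by gcongr)
  -- The three-dimensional span of `v₁, v₂, e` contains a nonzero vector orthogonal to both `β₁` and
  -- `β₂`. All three eigenvalues are at least `l`, so the form there is at least `l` times the
  -- squared norm, while `h` bounds it by `a`.
  let comb : (Fin 3 → ℝ) →ₗ[ℝ] Vec k := Fintype.linearCombination ℝ ![v₁, v₂, e]
  let f : (Fin 3 → ℝ) →ₗ[ℝ] (Fin 2 → ℝ) :=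
    LinearMap.pi ![(innerₛₗ ℝ β₁).comp comb, (innerₛₗ ℝ β₂).comp comb]
  have hker : LinearMap.ker f ≠ ⊥ := LinearMap.ker_ne_bot_of_finrank_lt (by simp)
  obtain ⟨c, hc, hc0⟩ := (Submodule.ne_bot_iff _).1 hker
  have hcomb : comb c = c 0 • v₁ + c 1 • v₂ + c 2 • e := by
    simp [comb, Fintype.linearCombination_apply, Fin.sum_univ_three]
  have hf0 : inner ℝ β₁ (comb c) = 0 := congrFun (LinearMap.mem_ker.1 hc) 0
  have hf1 : inner ℝ β₂ (comb c) = 0 := congrFun (LinearMap.mem_ker.1 hc) 1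
  have hform := h _ hf0 hf1
  have r1 := real_inner_self_eq_norm_sq v₁
  have r2 := real_inner_self_eq_norm_sq v₂
  have r3 := real_inner_self_eq_norm_sq e
  rw [hv₁] at r1
  rw [hv₂] at r2
  rw [he] at r3
  have s1 : inner ℝ v₂ v₁ = 0 := by rw [real_inner_comm]; exact hv₁₂
  have s2 : inner ℝ e v₁ = 0 := by rw [real_inner_comm]; exact he₁
  have s3 : inner ℝ e v₂ = 0 := by rw [real_inner_comm]; exact he₂
  rw [← real_inner_self_eq_norm_sq, hcomb] at hform
  simp only [map_add, map_smul, hl₁, hl₂, hle, inner_add_left, inner_add_right, inner_smul_left,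
    inner_smul_right, conj_trivial, r1, r2, r3, s1, s2, s3, hv₁₂, he₁, he₂] at hform
  have hpos : 0 < c 0 ^ 2 + c 1 ^ 2 + c 2 ^ 2 := by
    by_contra! hle
    have q0 := sq_nonneg (c 0)
    have q1 := sq_nonneg (c 1)
    have q2 := sq_nonneg (c 2)
    have z0 : c 0 = 0 := pow_eq_zero_iff two_ne_zero |>.1 (by linarith)
    have z1 : c 1 = 0 := pow_eq_zero_iff two_ne_zero |>.1 (by linarith)
    have z2 : c 2 = 0 := pow_eq_zero_iff two_ne_zero |>.1 (by linarith)
    apply hc0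
    ext i
    fin_cases i
    exacts [z0, z1, z2]
  have m0 := mul_nonneg (sq_nonneg (c 0)) (sub_nonneg.2 (hll.trans hl))
  have m1 := mul_nonneg (sq_nonneg (c 1)) (sub_nonneg.2 hll)
  refine le_of_mul_le_mul_right ?_ hpos
  linear_combination hform + m0 + m1

end TopTwo

/-! ### The grid on the circle, and its distance to nearby unit vectors. -/

section Grid

variable {k : ℕ}

lemma norm_circle_sub_le {v₁ v₂ : Vec k} (h₁ : ‖v₁‖ = 1) (h₂ : ‖v₂‖ = 1)
    (h₁₂ : inner ℝ v₁ v₂ = 0) (a b : ℝ) :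
    ‖(Real.cos a • v₁ + Real.sin a • v₂) - (Real.cos b • v₁ + Real.sin b • v₂)‖ ≤ |a - b| := by
  have e : (Real.cos a • v₁ + Real.sin a • v₂) - (Real.cos b • v₁ + Real.sin b • v₂)
      = (Real.cos a - Real.cos b) • v₁ + (Real.sin a - Real.sin b) • v₂ := by
    rw [sub_smul, sub_smul]; abel
  rw [e, ← abs_of_nonneg (norm_nonneg _), ← sq_le_sq, norm_add_sq_real, inner_smul_left,
    inner_smul_right, h₁₂, norm_smul, norm_smul, h₁, h₂]
  have hc := Real.one_sub_sq_div_two_le_cos (x := a - b)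
  rw [Real.cos_sub] at hc
  simp only [Real.norm_eq_abs, mul_one, sq_abs, mul_zero, add_zero]
  nlinarith [Real.sin_sq_add_cos_sq a, Real.sin_sq_add_cos_sq b]

lemma exists_angle (a b : ℝ) : ∃ θ : ℝ, 0 ≤ θ ∧ θ ≤ 2 * Real.pi ∧
    a = Real.sqrt (a ^ 2 + b ^ 2) * Real.cos θ ∧ b = Real.sqrt (a ^ 2 + b ^ 2) * Real.sin θ := by
  have hn : ‖(⟨a, b⟩ : ℂ)‖ = Real.sqrt (a ^ 2 + b ^ 2) := by
    rw [Complex.norm_eq_sqrt_sq_add_sq]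
  have h1 := Complex.norm_mul_cos_arg (⟨a, b⟩ : ℂ)
  have h2 := Complex.norm_mul_sin_arg (⟨a, b⟩ : ℂ)
  have h3 := Complex.neg_pi_lt_arg (⟨a, b⟩ : ℂ)
  have h4 := Complex.arg_le_pi (⟨a, b⟩ : ℂ)
  rw [hn] at h1 h2
  have := Real.pi_pos
  by_cases h0 : 0 ≤ Complex.arg ⟨a, b⟩
  · exact ⟨_, h0, by linarith, h1.symm, h2.symm⟩
  · refine ⟨Complex.arg ⟨a, b⟩ + 2 * Real.pi, by linarith, by linarith, ?_, ?_⟩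
    · rw [Real.cos_add_two_pi]; exact h1.symm
    · rw [Real.sin_add_two_pi]; exact h2.symm

lemma exists_mem_grid_near_circle {v₁ v₂ : Vec k} (h₁ : ‖v₁‖ = 1) (h₂ : ‖v₂‖ = 1)
    (h₁₂ : inner ℝ v₁ v₂ = 0) {δ θ : ℝ} (hδ : 0 < δ) (hθ₀ : 0 ≤ θ) (hθ : θ ≤ 2 * Real.pi) :
    ∃ u ∈ grid δ v₁ v₂, ‖u - (Real.cos θ • v₁ + Real.sin θ • v₂)‖ ≤ δ / 2 := by
  -- Rounding to the nearest multiple of `δ` costs half a step; the ceiling in the grid leaves room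
  -- when this rounds past `2π`.
  set t := ⌊θ / δ + 1 / 2⌋₊
  have hq : 0 ≤ θ / δ := by positivity
  have ht1 : (t : ℝ) ≤ θ / δ + 1 / 2 := Nat.floor_le (by positivity)
  have ht2 : θ / δ + 1 / 2 < t + 1 := Nat.lt_floor_add_one _
  refine ⟨_, ⟨t, ?_, rfl⟩, (norm_circle_sub_le h₁ h₂ h₁₂ _ _).trans ?_⟩
  · have h3 : θ / δ ≤ 2 * Real.pi / δ := by gcongr
    have h4 := Nat.le_ceil (2 * Real.pi / δ)
    have h5 : (t : ℝ) < ⌈2 * Real.pi / δ⌉₊ + 1 := by linarith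
    exact Nat.lt_succ_iff.1 (by exact_mod_cast h5)
  · have e : θ = δ * (θ / δ) := by field_simp
    rw [abs_le]
    constructor <;> nlinarith

/-- A unit vector close to the plane of `v₁, v₂` is close to a grid point. -/
lemma exists_mem_grid_near {v₁ v₂ β : Vec k} (h₁ : ‖v₁‖ = 1) (h₂ : ‖v₂‖ = 1)
    (h₁₂ : inner ℝ v₁ v₂ = 0) (hβ : ‖β‖ = 1) {δ e : ℝ} (hδ : 0 < δ)
    (he : ‖β - (inner ℝ v₁ β • v₁ + inner ℝ v₂ β • v₂)‖ ^ 2 ≤ e) :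
    ∃ u ∈ grid δ v₁ v₂, ‖u - β‖ ≤ δ / 2 + Real.sqrt (2 * e) := by
  set a : ℝ := inner ℝ v₁ β with ha
  set b : ℝ := inner ℝ v₂ β with hb
  have hcirc : ∀ c d : ℝ, ‖c • v₁ + d • v₂ - β‖ ^ 2 = c ^ 2 + d ^ 2 - 2 * (a * c + b * d) + 1 := by
    intro c d
    rw [norm_sub_sq_real, norm_add_sq_real, inner_add_left, inner_smul_left, inner_smul_left,
      inner_smul_left, inner_smul_right, h₁₂, norm_smul, norm_smul, h₁, h₂, hβ, ← ha, ← hb]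
    simp only [Real.norm_eq_abs, mul_one, sq_abs, mul_zero, add_zero, conj_trivial]
    ring
  rw [norm_sub_rev, hcirc] at he
  obtain ⟨θ, hθ0, hθ, hac, hbs⟩ := exists_angle a b
  obtain ⟨u, hu, hu'⟩ := exists_mem_grid_near_circle h₁ h₂ h₁₂ hδ hθ0 hθ
  refine ⟨u, hu, ?_⟩
  set r := Real.sqrt (a ^ 2 + b ^ 2) with hr
  have hr0 : 0 ≤ r := Real.sqrt_nonneg _
  have hr2 : r ^ 2 = a ^ 2 + b ^ 2 := Real.sq_sqrt (by positivity)
  have hr1 : r ≤ 1 := by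
    have := sq_nonneg ‖a • v₁ + b • v₂ - β‖
    rw [hcirc] at this
    nlinarith
  -- Normalising the projection of length `r` gives squared distance `2 - 2r`, and `2 - 2r ≤ 2(1 -
  -- r²) ≤ 2e` since `0 ≤ r ≤ 1`.
  have hv : ‖Real.cos θ • v₁ + Real.sin θ • v₂ - β‖ ≤ Real.sqrt (2 * e) := by
    apply Real.le_sqrt_of_sq_le
    rw [hcirc]
    have hsc := Real.sin_sq_add_cos_sq θ
    have : a * Real.cos θ + b * Real.sin θ = r := by
      calc a * Real.cos θ + b * Real.sin θ
          = r * (Real.sin θ ^ 2 + Real.cos θ ^ 2) := by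
            conv_lhs => rw [hac, hbs]
            ring
        _ = r := by rw [hsc, mul_one]
    nlinarith
  calc ‖u - β‖ ≤ _ := norm_sub_le_norm_sub_add_norm_sub u (Real.cos θ • v₁ + Real.sin θ • v₂) β
    _ ≤ _ := add_le_add hu' hv

/-- If the quadratic form of `M` is `e`-close to that of `1 + 2 (p₁ β₁β₁ᵀ + p₂ β₂β₂ᵀ)`, then each
`β_b` is close to the plane of the top two eigenvectors. -/
lemma IsTopTwo.mul_norm_sub_proj_sq_le {M : Vec k →L[ℝ] Vec k} (hM : M.IsSymmetric)
    {v₁ v₂ β₁ β₂ : Vec k} (hv : IsTopTwo M v₁ v₂) {p₁ p₂ e : ℝ}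
    (h : ∀ w, |inner ℝ (M w) w - (‖w‖ ^ 2 + 2 * (p₁ * (inner ℝ β₁ w) ^ 2 + p₂ * (inner ℝ β₂ w) ^ 2))|
      ≤ e * ‖w‖ ^ 2) (he : 0 ≤ e) (u : Vec k)
    {p : ℝ} (hu : ∀ w, p * (inner ℝ u w) ^ 2 ≤ p₁ * (inner ℝ β₁ w) ^ 2 + p₂ * (inner ℝ β₂ w) ^ 2) :
    p * ‖u - (inner ℝ v₁ u • v₁ + inner ℝ v₂ u • v₂)‖ ^ 2 ≤ e := by
  have hv' := hv
  obtain ⟨h₁, h₂, h₁₂, -⟩ := hv'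
  have h₂₁ : inner ℝ v₂ v₁ = 0 := by rw [real_inner_comm]; exact h₁₂
  set w := u - (inner ℝ v₁ u • v₁ + inner ℝ v₂ u • v₂) with hw
  have hw₁ : inner ℝ v₁ w = 0 := by
    rw [hw, inner_sub_right, inner_add_right, inner_smul_right, inner_smul_right, h₁₂,
      real_inner_self_eq_norm_sq, h₁]; ring
  have hw₂ : inner ℝ v₂ w = 0 := by
    rw [hw, inner_sub_right, inner_add_right, inner_smul_right, inner_smul_right, h₂₁,
      real_inner_self_eq_norm_sq, h₂]; ring
  have huw : inner ℝ u w = ‖w‖ ^ 2 := by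
    have : u = w + (inner ℝ v₁ u • v₁ + inner ℝ v₂ u • v₂) := by rw [hw]; abel
    nth_rewrite 1 [this]
    rw [inner_add_left, inner_add_left, inner_smul_left, inner_smul_left, hw₁, hw₂,
      real_inner_self_eq_norm_sq]; ring
  -- On the complement of `β₁, β₂` the model form is `‖·‖²`, so the min-max bound applies with `1 +
  -- e`. Together with the lower bound at `w` it gives `2p‖w‖⁴ ≤ 2e‖w‖²`.
  have hup := hv.form_le hM (β₁ := β₁) (β₂ := β₂) (a := 1 + e) (fun x hx₁ hx₂ => by
    have := (abs_le.1 (h x)).2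
    rw [hx₁, hx₂] at this
    linarith) hw₁ hw₂
  have hlo := (abs_le.1 (h w)).1
  have hpu := hu w
  rw [huw] at hpu
  rcases eq_or_ne (‖w‖ ^ 2) 0 with h0 | h0
  · rw [h0]; simpa using he
  · have hpos : 0 < ‖w‖ ^ 2 := lt_of_le_of_ne (by positivity) h0.symm
    by_contra! hcon
    nlinarith

end Grid

/-! ### Expectations over one sample and the Chernoff bound for sums. -/

section Chernoff

variable {k N : ℕ} {Ω : Type*} [MeasurableSpace Ω] {μ : Measure Ω}
  {p₁ : ℝ} {x : Fin N → Ω → Vec k} {z : Fin N → Ω → Bool}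

lemma IsMixedDesign.integrable_comp_x (hd : IsMixedDesign μ p₁ x z) (i : Fin N) {g : Vec k → ℝ}
    (hg : Integrable g (stdGaussian (Vec k))) : Integrable (fun ω => g (x i ω)) μ := by
  rw [← hd.law_x i] at hg
  exact hg.comp_measurable (hd.measurable_x i)

lemma IsMixedDesign.integral_comp_x (hd : IsMixedDesign μ p₁ x z) (i : Fin N) {g : Vec k → ℝ}
    (hg : Measurable g) : ∫ ω, g (x i ω) ∂μ = ∫ v, g v ∂(stdGaussian (Vec k)) := by
  rw [← hd.law_x i, integral_map (hd.measurable_x i).aemeasurable hg.aestronglyMeasurable]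

lemma measurable_uncurry_bool {g : Vec k → Bool → ℝ} (hg : ∀ b, Measurable fun v => g v b) :
    Measurable fun q : Vec k × Bool => g q.1 q.2 :=
  measurable_from_prod_countable_left hg

lemma IsMixedDesign.measurable_comp (hd : IsMixedDesign μ p₁ x z) (i : Fin N)
    {g : Vec k → Bool → ℝ} (hg : ∀ b, Measurable fun v => g v b) :
    Measurable fun ω => g (x i ω) (z i ω) :=
  (measurable_uncurry_bool hg).comp ((hd.measurable_x i).prodMk (hd.measurable_z i))

variable [IsProbabilityMeasure μ]

lemma IsMixedDesign.measure_label_false (hd : IsMixedDesign μ p₁ x z) (i : Fin N) :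
    μ.real {ω | z i ω = false} = 1 - p₁ := by
  have hm : MeasurableSet {ω | z i ω = true} := hd.measurable_z i (measurableSet_singleton true)
  have e : {ω | z i ω = false} = {ω | z i ω = true}ᶜ := by ext ω; simp
  rw [e, probReal_compl_eq_one_sub hm, hd.prob_z i]

/-- Integrability and integral of a function of one sample `(x_i, z_i)`. -/
lemma IsMixedDesign.integral_comp (hd : IsMixedDesign μ p₁ x z) (i : Fin N) {g : Vec k → Bool → ℝ}
    (hgm : ∀ b, Measurable fun v => g v b)
    (hg : ∀ b, Integrable (fun v => g v b) (stdGaussian (Vec k))) :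
    Integrable (fun ω => g (x i ω) (z i ω)) μ ∧
      ∫ ω, g (x i ω) (z i ω) ∂μ = p₁ * ∫ v, g v true ∂(stdGaussian (Vec k))
        + (1 - p₁) * ∫ v, g v false ∂(stdGaussian (Vec k)) := by
  let φ : Bool → Bool → ℝ := fun b c => if c = b then 1 else 0
  have hφm : ∀ b, Measurable fun ω => φ b (z i ω) := fun b =>
    (measurable_of_finite (φ b)).comp (hd.measurable_z i)
  have hφi : ∀ b, Integrable (fun ω => φ b (z i ω)) μ := fun b =>
    (integrable_const (1 : ℝ)).mono' (hφm b).aestronglyMeasurable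
      (ae_of_all _ fun ω => by simp only [φ]; split <;> simp)
  have hφ : ∀ b, ∫ ω, φ b (z i ω) ∂μ = μ.real {ω | z i ω = b} := by
    intro b
    have e : (fun ω => φ b (z i ω)) = Set.indicator {ω | z i ω = b} 1 := by
      funext ω; simp [φ, Set.indicator_apply]
    rw [e]
    exact integral_indicator_one (hd.measurable_z i (measurableSet_singleton b))
  have hind : ∀ b, IndepFun (fun ω => g (x i ω) b) (fun ω => φ b (z i ω)) μ := fun b =>
    (hd.indep_x_z i).comp (hgm b) (measurable_of_finite (φ b))
  have hprod : ∀ b, Integrable (fun ω => g (x i ω) b * φ b (z i ω)) μ := fun b =>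
    (hind b).integrable_mul (hd.integrable_comp_x i (hg b)) (hφi b)
  have hval : ∀ b, ∫ ω, g (x i ω) b * φ b (z i ω) ∂μ
      = (∫ v, g v b ∂(stdGaussian (Vec k))) * μ.real {ω | z i ω = b} := by
    intro b
    rw [(hind b).integral_fun_mul_eq_mul_integral
      ((hgm b).comp (hd.measurable_x i)).aestronglyMeasurable (hφm b).aestronglyMeasurable,
      hφ, hd.integral_comp_x i (hgm b)]
  have hsum : (fun ω => g (x i ω) (z i ω))
      = fun ω => g (x i ω) true * φ true (z i ω) + g (x i ω) false * φ false (z i ω) := by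
    funext ω
    cases h : z i ω <;> simp [φ]
  rw [hsum]
  refine ⟨(hprod true).add (hprod false), ?_⟩
  rw [integral_add (hprod true) (hprod false), hval, hval, hd.prob_z, hd.measure_label_false]
  ring

/-- Chernoff bound for a sum of a function of the samples. -/
lemma IsMixedDesign.measure_sum_ge_le (hd : IsMixedDesign μ p₁ x z) (S : Finset (Fin N))
    {f : Vec k → Bool → ℝ} (hf : ∀ b, Measurable fun v => f v b)
    (hint : ∀ b, Integrable (fun v => Real.exp (f v b)) (stdGaussian (Vec k))) {A : ℝ}
    (hA : p₁ * ∫ v, Real.exp (f v true) ∂(stdGaussian (Vec k))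
        + (1 - p₁) * ∫ v, Real.exp (f v false) ∂(stdGaussian (Vec k)) ≤ Real.exp A) (t : ℝ) :
    μ.real {ω | t ≤ ∑ i ∈ S, f (x i ω) (z i ω)} ≤ Real.exp (S.card * A - t) := by
  let X : Fin N → Ω → ℝ := fun i ω => f (x i ω) (z i ω)
  have hX : ∀ i, Measurable (X i) := fun i => hd.measurable_comp i hf
  have hindep : iIndepFun X μ :=
    hd.indep.comp (fun _ q => f q.1 q.2) (fun _ => measurable_uncurry_bool hf)
  have hXi := fun i => hd.integral_comp i (g := fun v b => Real.exp (f v b))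
    (fun b => (hf b).exp) hint
  have hI : Integrable (fun ω => Real.exp (1 * (∑ i ∈ S, X i) ω)) μ :=
    hindep.integrable_exp_mul_sum hX (fun i _ => by simpa [X] using (hXi i).1)
  have hmgf : ∀ i, mgf (X i) μ 1 ≤ Real.exp A := by
    intro i
    simp only [mgf, one_mul, X]
    rw [(hXi i).2]
    exact hA
  -- The Chernoff parameter is fixed at 1; applications put their scale into `f`.
  have h := measure_ge_le_exp_mul_mgf t zero_le_one hI
  rw [hindep.mgf_sum hX S] at h
  have hprod : ∏ i ∈ S, mgf (X i) μ 1 ≤ Real.exp A ^ S.card :=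
    (Finset.prod_le_prod (fun i _ => mgf_nonneg) fun i _ => hmgf i).trans (by simp)
  calc μ.real {ω | t ≤ ∑ i ∈ S, f (x i ω) (z i ω)}
      = μ.real {ω | t ≤ (∑ i ∈ S, X i) ω} := by simp only [Finset.sum_apply, X]
    _ ≤ Real.exp (-1 * t) * Real.exp A ^ S.card := h.trans (by gcongr)
    _ = Real.exp (S.card * A - t) := by
      rw [← Real.exp_nat_mul, ← Real.exp_add]; ring_nf

end Chernoff

/-! ### Laplace transforms of a single summand. -/

section SingleSample

variable {k : ℕ}

lemma exp_le_one_add_sq_mul_exp {u : ℝ} (hu : 0 ≤ u) :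
    Real.exp u ≤ 1 + u + u ^ 2 * Real.exp u := by
  have h1 : Real.exp u - 1 ≤ u * Real.exp u := by
    have h := Real.one_sub_le_exp_neg u
    rw [Real.exp_neg] at h
    have := mul_le_mul_of_nonneg_right h (Real.exp_pos u).le
    rw [inv_mul_cancel₀ (Real.exp_pos u).ne'] at this
    linarith
  nlinarith

lemma exp_neg_le_one_sub_add_sq {u : ℝ} (hu : 0 ≤ u) : Real.exp (-u) ≤ 1 - u + u ^ 2 := by
  have h : 1 + u ≤ Real.exp u := by linarith [Real.add_one_le_exp u]
  rw [Real.exp_neg]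
  calc (Real.exp u)⁻¹ ≤ (1 + u)⁻¹ := by gcongr
    _ ≤ 1 - u + u ^ 2 := by
      rw [inv_le_iff_one_le_mul₀ (by linarith)]
      nlinarith [pow_nonneg hu 3]

/-- The arithmetic-geometric mean inequality decouples the two projections. The exponent `3/8` stays
below the integrability threshold `1/2`, and `131072 = 512²/2`. -/
lemma pow_four_mul_pow_four_mul_exp_le (s t : ℝ) :
    s ^ 4 * t ^ 4 * Real.exp (1 / 8 * t ^ 2)
      ≤ 131072 * (Real.exp (1 / 8 * s ^ 2) + Real.exp (3 / 8 * t ^ 2)) := by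
  have e1 : Real.exp (1 / 8 * s ^ 2) = Real.exp (1 / 16 * s ^ 2) ^ 2 := by
    rw [← Real.exp_nat_mul]; ring_nf
  have e2 : Real.exp (3 / 8 * t ^ 2)
      = (Real.exp (1 / 16 * t ^ 2) * Real.exp (1 / 8 * t ^ 2)) ^ 2 := by
    rw [← Real.exp_add, ← Real.exp_nat_mul]; ring_nf
  rw [e1, e2]
  have h := mul_le_mul (pow_four_le_exp s) (pow_four_le_exp t) (by positivity) (by positivity)
  have h2 := mul_le_mul_of_nonneg_right h (Real.exp_pos (1 / 8 * t ^ 2)).le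
  nlinarith [sq_nonneg (Real.exp (1 / 16 * s ^ 2)
    - Real.exp (1 / 16 * t ^ 2) * Real.exp (1 / 8 * t ^ 2))]

lemma integrable_pow_four_mul_exp {a w : Vec k} (ha : ‖a‖ = 1) (hw : ‖w‖ = 1) :
    Integrable (fun v : Vec k => (inner ℝ v a : ℝ) ^ 4 * (inner ℝ v w) ^ 4
      * Real.exp (1 / 8 * (inner ℝ v w) ^ 2)) (stdGaussian (Vec k)) := by
  refine (((integrable_exp_mul_inner_sq ha (s := 1 / 8) (by norm_num)).add
    (integrable_exp_mul_inner_sq hw (s := 3 / 8) (by norm_num))).const_mul 131072).mono'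
    (by fun_prop) (ae_of_all _ fun v => ?_)
  rw [Real.norm_of_nonneg (by positivity)]
  exact pow_four_mul_pow_four_mul_exp_le _ _

lemma integral_pow_four_mul_exp_le {a w : Vec k} (ha : ‖a‖ = 1) (hw : ‖w‖ = 1) :
    ∫ v, (inner ℝ v a : ℝ) ^ 4 * (inner ℝ v w) ^ 4
      * Real.exp (1 / 8 * (inner ℝ v w) ^ 2) ∂(stdGaussian (Vec k)) ≤ 524288 := by
  have i1 := integrable_exp_mul_inner_sq ha (s := 1 / 8) (by norm_num)
  have i2 := integrable_exp_mul_inner_sq hw (s := 3 / 8) (by norm_num)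
  refine (integral_mono (integrable_pow_four_mul_exp ha hw) ((i1.add i2).const_mul 131072)
    fun v => pow_four_mul_pow_four_mul_exp_le _ _).trans ?_
  simp only [Pi.add_apply]
  rw [integral_const_mul, integral_add i1 i2, integral_exp_mul_inner_sq ha (by norm_num),
    integral_exp_mul_inner_sq hw (by norm_num)]
  have q : ∀ r : ℝ, 1 / 4 ≤ r → (Real.sqrt r)⁻¹ ≤ 2 := by
    intro r hr
    rw [inv_le_comm₀ (Real.sqrt_pos.2 (by linarith)) two_pos]
    exact Real.le_sqrt_of_sq_le (by norm_num; linarith)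
  have := q (1 - 2 * (1 / 8)) (by norm_num)
  have := q (1 - 2 * (3 / 8)) (by norm_num)
  linarith

/-- Second-order bound for the Laplace transform of `c ⟨v, a⟩² ⟨v, w⟩²` and its truncations. -/
lemma integral_exp_le_of_le {a w : Vec k} (ha : ‖a‖ = 1) (hw : ‖w‖ = 1) {F : Vec k → ℝ}
    (hF : Measurable F) {c : ℝ} (h : ∀ v, Real.exp (F v) ≤ 1
      + c * ((inner ℝ v a : ℝ) ^ 2 * (inner ℝ v w) ^ 2)
      + c ^ 2 * ((inner ℝ v a : ℝ) ^ 4 * (inner ℝ v w) ^ 4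
        * Real.exp (1 / 8 * (inner ℝ v w) ^ 2))) :
    Integrable (fun v => Real.exp (F v)) (stdGaussian (Vec k)) ∧
      ∫ v, Real.exp (F v) ∂(stdGaussian (Vec k))
        ≤ 1 + c * (1 + 2 * (inner ℝ a w) ^ 2) + c ^ 2 * 524288 := by
  have i1 := (integrable_inner_sq_mul_inner_sq a w).const_mul c
  have i2 := (integrable_pow_four_mul_exp ha hw).const_mul (c ^ 2)
  have i0 : Integrable (fun v : Vec k => 1 + c * ((inner ℝ v a : ℝ) ^ 2 * (inner ℝ v w) ^ 2))
    (stdGaussian (Vec k)) := (integrable_const 1).add i1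
  have hi : Integrable (fun v => Real.exp (F v)) (stdGaussian (Vec k)) :=
    (i0.add i2).mono' hF.exp.aestronglyMeasurable (ae_of_all _ fun v => by
      rw [Real.norm_of_nonneg (Real.exp_pos _).le]; exact h v)
  refine ⟨hi, (integral_mono hi (i0.add i2) h).trans ?_⟩
  simp only [Pi.add_apply]
  rw [integral_add i0 i2, integral_add (integrable_const 1) i1, integral_const_mul,
    integral_const_mul, integral_inner_sq_mul_inner_sq ha hw]
  have := mul_le_mul_of_nonneg_left (integral_pow_four_mul_exp_le ha hw) (sq_nonneg c)
  simp only [integral_const, probReal_univ, smul_eq_mul, mul_one]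
  linarith

/-- Truncation is used only to keep the exponent below `⟨v,w⟩²/8`, which is integrable; the
first-order term is bounded by its untruncated mean. -/
lemma integral_exp_truncated_le {a w : Vec k} (ha : ‖a‖ = 1) (hw : ‖w‖ = 1) {c τ : ℝ} (hc : 0 ≤ c)
    (hτ : 0 ≤ τ) (hcτ : c * τ ≤ 1 / 8) :
    Integrable (fun v => Real.exp (c * (min ((inner ℝ v a : ℝ) ^ 2) τ * (inner ℝ v w) ^ 2)))
      (stdGaussian (Vec k)) ∧
      ∫ v, Real.exp (c * (min ((inner ℝ v a : ℝ) ^ 2) τ * (inner ℝ v w) ^ 2))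
        ∂(stdGaussian (Vec k)) ≤ 1 + c * (1 + 2 * (inner ℝ a w) ^ 2) + c ^ 2 * 524288 := by
  refine integral_exp_le_of_le ha hw (by fun_prop) fun v => ?_
  set s : ℝ := inner ℝ v a
  set t : ℝ := inner ℝ v w
  have m0 : 0 ≤ min (s ^ 2) τ := le_min (sq_nonneg _) hτ
  have m1 : min (s ^ 2) τ ≤ s ^ 2 := min_le_left _ _
  have m2 : min (s ^ 2) τ ≤ τ := min_le_right _ _
  have u0 : 0 ≤ c * (min (s ^ 2) τ * t ^ 2) := by positivity
  refine (exp_le_one_add_sq_mul_exp u0).trans ?_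
  have h1 : c * (min (s ^ 2) τ * t ^ 2) ≤ c * (s ^ 2 * t ^ 2) := by gcongr
  have h2 : (c * (min (s ^ 2) τ * t ^ 2)) ^ 2 ≤ c ^ 2 * (s ^ 4 * t ^ 4) := by
    calc _ ≤ (c * (s ^ 2 * t ^ 2)) ^ 2 := by gcongr
      _ = _ := by ring
  have h3 : Real.exp (c * (min (s ^ 2) τ * t ^ 2)) ≤ Real.exp (1 / 8 * t ^ 2) := by
    apply Real.exp_le_exp.2
    rw [← mul_assoc]
    have : c * min (s ^ 2) τ ≤ 1 / 8 := (by gcongr : c * min (s ^ 2) τ ≤ c * τ).trans hcτ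
    gcongr
  have h4 := mul_le_mul h2 h3 (Real.exp_pos _).le (by positivity)
  linarith

/-- A nonpositive exponent needs no truncation; the factor `exp(⟨v,w⟩²/8) ≥ 1` is inserted only to
share the remainder bound with the upper tail. -/
lemma integral_exp_neg_le {a w : Vec k} (ha : ‖a‖ = 1) (hw : ‖w‖ = 1) {c : ℝ} (hc : 0 ≤ c) :
    Integrable (fun v => Real.exp (-c * ((inner ℝ v a : ℝ) ^ 2 * (inner ℝ v w) ^ 2)))
      (stdGaussian (Vec k)) ∧
      ∫ v, Real.exp (-c * ((inner ℝ v a : ℝ) ^ 2 * (inner ℝ v w) ^ 2))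
        ∂(stdGaussian (Vec k)) ≤ 1 + -c * (1 + 2 * (inner ℝ a w) ^ 2) + (-c) ^ 2 * 524288 := by
  refine integral_exp_le_of_le ha hw (by fun_prop) fun v => ?_
  set s : ℝ := inner ℝ v a
  set t : ℝ := inner ℝ v w
  have u0 : 0 ≤ c * (s ^ 2 * t ^ 2) := by positivity
  rw [neg_mul]
  refine (exp_neg_le_one_sub_add_sq u0).trans ?_
  have h1 : (1 : ℝ) ≤ Real.exp (1 / 8 * t ^ 2) := Real.one_le_exp (by positivity)
  have h2 := mul_le_mul_of_nonneg_left h1 (show 0 ≤ c ^ 2 * (s ^ 4 * t ^ 4) by positivity)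
  linear_combination h2

/-- The exponential of the minimum is at most the sum of the two exponentials, each of integral
`1/√9`. The factor 4 brings the total below 1 whatever the correlation of the two projections. -/
lemma integral_exp_neg_min_le {a b : Vec k} (ha : ‖a‖ = 1) (hb : ‖b‖ = 1) :
    Integrable (fun v => Real.exp (-4 * min ((inner ℝ v a : ℝ) ^ 2) ((inner ℝ v b) ^ 2)))
      (stdGaussian (Vec k)) ∧
      ∫ v, Real.exp (-4 * min ((inner ℝ v a : ℝ) ^ 2) ((inner ℝ v b) ^ 2))
        ∂(stdGaussian (Vec k)) ≤ 2 / 3 := by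
  have i1 := integrable_exp_mul_inner_sq ha (s := -4) (by norm_num)
  have i2 := integrable_exp_mul_inner_sq hb (s := -4) (by norm_num)
  have h : ∀ v : Vec k, Real.exp (-4 * min ((inner ℝ v a : ℝ) ^ 2) ((inner ℝ v b) ^ 2))
      ≤ Real.exp (-4 * (inner ℝ v a) ^ 2) + Real.exp (-4 * (inner ℝ v b) ^ 2) := by
    intro v
    rcases min_choice ((inner ℝ v a : ℝ) ^ 2) ((inner ℝ v b) ^ 2) with h | h <;> rw [h]
    · linarith [Real.exp_pos (-4 * (inner ℝ v b : ℝ) ^ 2)]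
    · linarith [Real.exp_pos (-4 * (inner ℝ v a : ℝ) ^ 2)]
  have hi : Integrable (fun v => Real.exp (-4 * min ((inner ℝ v a : ℝ) ^ 2) ((inner ℝ v b) ^ 2)))
      (stdGaussian (Vec k)) :=
    (i1.add i2).mono' (by fun_prop) (ae_of_all _ fun v => by
      rw [Real.norm_of_nonneg (Real.exp_pos _).le]; exact h v)
  refine ⟨hi, (integral_mono hi (i1.add i2) h).trans ?_⟩
  simp only [Pi.add_apply]
  rw [integral_add i1 i2, integral_exp_mul_inner_sq ha (by norm_num),
    integral_exp_mul_inner_sq hb (by norm_num), show (1 : ℝ) - 2 * -4 = 3 ^ 2 by norm_num,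
    Real.sqrt_sq (by norm_num)]
  norm_num

end SingleSample

/-! ### High-probability events over a finite set of directions. -/

section Events

variable {k N : ℕ} {Ω : Type*} [MeasurableSpace Ω] {μ : Measure Ω}
  {p₁ : ℝ} {x : Fin N → Ω → Vec k} {z : Fin N → Ω → Bool}

lemma inv_sqrt_half_le_two : (Real.sqrt (1 - 2 * (1 / 4 : ℝ)))⁻¹ ≤ 2 := by
  rw [inv_le_comm₀ (Real.sqrt_pos.2 (by norm_num)) two_pos]
  exact Real.le_sqrt_of_sq_le (by norm_num)

lemma measurable_response (β₁ β₂ : Vec k) (b : Bool) :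
    Measurable fun v : Vec k => response β₁ β₂ v b := by
  cases b
  · simpa [response] using measurable_inner_right β₂
  · simpa [response] using measurable_inner_right β₁

lemma IsMixedDesign.measurable_sum (hd : IsMixedDesign μ p₁ x z) (S : Finset (Fin N))
    {g : Vec k → Bool → ℝ} (hg : ∀ b, Measurable fun v => g v b) :
    Measurable fun ω => ∑ i ∈ S, g (x i ω) (z i ω) :=
  Finset.measurable_sum _ fun i _ => hd.measurable_comp i hg

variable [IsProbabilityMeasure μ]

lemma IsMixedDesign.measure_response_sq_ge_le (hd : IsMixedDesign μ p₁ x z)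
    {β₁ β₂ : Vec k} (hβ₁ : ‖β₁‖ = 1) (hβ₂ : ‖β₂‖ = 1) (i : Fin N) (τ : ℝ) :
    μ.real {ω | τ ≤ response β₁ β₂ (x i ω) (z i ω) ^ 2} ≤ 2 * Real.exp (-τ / 4) := by
  have h := hd.measure_sum_ge_le {i} (f := fun v b => 1 / 4 * response β₁ β₂ v b ^ 2)
    (fun b => ((measurable_response β₁ β₂ b).pow_const 2).const_mul _)
    (fun b => by
      cases b
      · simpa [response] using integrable_exp_mul_inner_sq hβ₂ (s := 1 / 4) (by norm_num)
      · simpa [response] using integrable_exp_mul_inner_sq hβ₁ (s := 1 / 4) (by norm_num))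
    (A := Real.log 2)
    (by
      simp only [response, if_true, Bool.false_eq_true, if_false]
      rw [integral_exp_mul_inner_sq hβ₁ (by norm_num), integral_exp_mul_inner_sq hβ₂ (by norm_num),
        ← add_mul, Real.exp_log two_pos]
      linarith [inv_sqrt_half_le_two]) (1 / 4 * τ)
  have e : {ω | 1 / 4 * τ ≤ ∑ j ∈ ({i} : Finset (Fin N)),
      1 / 4 * response β₁ β₂ (x j ω) (z j ω) ^ 2}
      = {ω | τ ≤ response β₁ β₂ (x i ω) (z i ω) ^ 2} := by
    ext ω
    simp only [Finset.sum_singleton, Set.mem_ofPred_eq]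
    constructor <;> intro h <;> linarith
  rw [e] at h
  refine h.trans (le_of_eq ?_)
  rw [Finset.card_singleton, Nat.cast_one, one_mul, Real.exp_sub, Real.exp_log two_pos,
    div_eq_mul_inv, ← Real.exp_neg]
  ring_nf

/-- On an event of large probability, the empirical second moments weighted by the squared
responses are close to their means in all directions of a finite set. -/
lemma IsMixedDesign.exists_event_moment (hd : IsMixedDesign μ p₁ x z) (hp₀ : 0 ≤ p₁)
    (hp₁ : p₁ ≤ 1) {β₁ β₂ : Vec k} (hβ₁ : ‖β₁‖ = 1) (hβ₂ : ‖β₂‖ = 1) (S : Finset (Fin N))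
    {T : Finset (Vec k)} (hT : ∀ t ∈ T, ‖t‖ = 1) {ε τ c : ℝ} (hc : 0 < c) (hτ : 0 ≤ τ)
    (hcτ : c * τ ≤ 1 / 8) (hcε : c * 524288 ≤ ε / 2) :
    ∃ G : Set Ω, MeasurableSet G ∧
      μ.real Gᶜ ≤ S.card * (2 * Real.exp (-τ / 4))
        + T.card * (2 * Real.exp (-(S.card * (c * ε / 2)))) ∧
      ∀ ω ∈ G, ∀ w ∈ T,
        |∑ i ∈ S, response β₁ β₂ (x i ω) (z i ω) ^ 2 * (inner ℝ (x i ω) w) ^ 2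
          - S.card * (1 + 2 * (p₁ * (inner ℝ β₁ w) ^ 2 + (1 - p₁) * (inner ℝ β₂ w) ^ 2))|
          ≤ S.card * ε := by
  have hq₀ : 0 ≤ 1 - p₁ := by linarith
  let m : Vec k → ℝ := fun w =>
    1 + 2 * (p₁ * (inner ℝ β₁ w) ^ 2 + (1 - p₁) * (inner ℝ β₂ w) ^ 2)
  let fU : Vec k → Vec k → Bool → ℝ := fun w v b =>
    c * (min (response β₁ β₂ v b ^ 2) τ * (inner ℝ v w) ^ 2)
  let fL : Vec k → Vec k → Bool → ℝ := fun w v b =>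
    -c * (response β₁ β₂ v b ^ 2 * (inner ℝ v w) ^ 2)
  have hfU : ∀ w b, Measurable fun v => fU w v b := fun w b =>
    ((((measurable_response β₁ β₂ b).pow_const 2).min measurable_const).mul
      ((measurable_inner_right w).pow_const 2)).const_mul c
  have hfL : ∀ w b, Measurable fun v => fL w v b := fun w b =>
    (((measurable_response β₁ β₂ b).pow_const 2).mul
      ((measurable_inner_right w).pow_const 2)).const_mul (-c)
  -- Bad events: `A` is a response too large for the truncation, `U` an upper deviation of the
  -- truncated sum, `L` a lower deviation of the untruncated sum. Off `A` the truncation is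
  -- inactive, so excluding `U` controls the true sum.
  let A : Fin N → Set Ω := fun i => {ω | τ ≤ response β₁ β₂ (x i ω) (z i ω) ^ 2}
  let U : Vec k → Set Ω := fun w => {ω | c * (S.card * (m w + ε)) ≤ ∑ i ∈ S, fU w (x i ω) (z i ω)}
  let L : Vec k → Set Ω := fun w =>
    {ω | -c * (S.card * (m w - ε)) ≤ ∑ i ∈ S, fL w (x i ω) (z i ω)}
  have hAm : ∀ i, MeasurableSet (A i) := fun i => measurableSet_le measurable_const
    ((hd.measurable_comp i (measurable_response β₁ β₂)).pow_const 2)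
  have hUm : ∀ w, MeasurableSet (U w) := fun w =>
    measurableSet_le measurable_const (hd.measurable_sum S (hfU w))
  have hLm : ∀ w, MeasurableSet (L w) := fun w =>
    measurableSet_le measurable_const (hd.measurable_sum S (hfL w))
  -- The choice of `c` lets the second-order term use up at most half of the gain `cε`.
  have hexp : S.card * (c ^ 2 * 524288 - c * ε) ≤ -(S.card * (c * ε / 2)) := by
    have : c ^ 2 * 524288 - c * ε ≤ -(c * ε / 2) := by nlinarith
    calc _ ≤ (S.card : ℝ) * -(c * ε / 2) := by gcongr
      _ = _ := by ring
  have hU : ∀ w ∈ T, μ.real (U w) ≤ Real.exp (-(S.card * (c * ε / 2))) := by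
    intro w hw
    have b1 := integral_exp_truncated_le hβ₁ (hT w hw) hc.le hτ hcτ
    have b2 := integral_exp_truncated_le hβ₂ (hT w hw) hc.le hτ hcτ
    refine (hd.measure_sum_ge_le S (hfU w) (fun b => ?_) (A := c * m w + c ^ 2 * 524288) ?_ _).trans
      (Real.exp_le_exp.2 ?_)
    · cases b
      · simpa [fU, response] using b2.1
      · simpa [fU, response] using b1.1
    · simp only [fU, response, if_true, Bool.false_eq_true, if_false]
      have h1 := mul_le_mul_of_nonneg_left b1.2 hp₀
      have h2 := mul_le_mul_of_nonneg_left b2.2 hq₀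
      have h3 := Real.add_one_le_exp (c * m w + c ^ 2 * 524288)
      simp only [m] at h3 ⊢
      linear_combination h1 + h2 + h3
    · linear_combination hexp
  have hL : ∀ w ∈ T, μ.real (L w) ≤ Real.exp (-(S.card * (c * ε / 2))) := by
    intro w hw
    have b1 := integral_exp_neg_le hβ₁ (hT w hw) hc.le
    have b2 := integral_exp_neg_le hβ₂ (hT w hw) hc.le
    refine (hd.measure_sum_ge_le S (hfL w) (fun b => ?_) (A := -c * m w + c ^ 2 * 524288) ?_ _).trans
      (Real.exp_le_exp.2 ?_)
    · cases b
      · simpa [fL, response] using b2.1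
      · simpa [fL, response] using b1.1
    · simp only [fL, response, if_true, Bool.false_eq_true, if_false]
      have h1 := mul_le_mul_of_nonneg_left b1.2 hp₀
      have h2 := mul_le_mul_of_nonneg_left b2.2 hq₀
      have h3 := Real.add_one_le_exp (-c * m w + c ^ 2 * 524288)
      simp only [m] at h3 ⊢
      linear_combination h1 + h2 + h3
    · linear_combination hexp
  refine ⟨((⋃ i ∈ S, A i) ∪ ⋃ w ∈ T, (U w ∪ L w))ᶜ, ?_, ?_, ?_⟩
  · exact ((S.measurableSet_biUnion fun i _ => hAm i).union
      (T.measurableSet_biUnion fun w _ => (hUm w).union (hLm w))).compl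
  · rw [compl_compl]
    refine (measureReal_union_le _ _).trans (add_le_add ?_ ?_)
    · refine (measureReal_biUnion_finset_le _ _).trans ?_
      rw [← nsmul_eq_mul]
      exact Finset.sum_le_card_nsmul _ _ _ fun i _ =>
        hd.measure_response_sq_ge_le hβ₁ hβ₂ i τ
    · refine (measureReal_biUnion_finset_le _ _).trans ?_
      rw [← nsmul_eq_mul]
      refine Finset.sum_le_card_nsmul _ _ _ fun w hw => (measureReal_union_le _ _).trans ?_
      linarith [hU w hw, hL w hw]
  · intro ω hω w hw
    simp only [Set.mem_compl_iff, Set.mem_union, Set.mem_iUnion, not_or, not_exists] at hω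
    obtain ⟨hωA, hωT⟩ := hω
    obtain ⟨hωU, hωL⟩ := hωT w hw
    have hωU' : ∑ i ∈ S, fU w (x i ω) (z i ω) < c * (S.card * (m w + ε)) := not_le.1 hωU
    have hωL' : ∑ i ∈ S, fL w (x i ω) (z i ω) < -c * (S.card * (m w - ε)) := not_le.1 hωL
    have hsumU : ∑ i ∈ S, fU w (x i ω) (z i ω)
        = c * ∑ i ∈ S, response β₁ β₂ (x i ω) (z i ω) ^ 2 * (inner ℝ (x i ω) w) ^ 2 := by
      rw [Finset.mul_sum]
      refine Finset.sum_congr rfl fun i hi => ?_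
      have : response β₁ β₂ (x i ω) (z i ω) ^ 2 < τ := not_le.1 (hωA i hi)
      simp only [fU]
      rw [min_eq_left this.le]
    have hsumL : ∑ i ∈ S, fL w (x i ω) (z i ω)
        = -c * ∑ i ∈ S, response β₁ β₂ (x i ω) (z i ω) ^ 2 * (inner ℝ (x i ω) w) ^ 2 := by
      rw [Finset.mul_sum]
    rw [hsumU] at hωU'
    rw [hsumL, neg_mul, neg_mul, neg_lt_neg_iff] at hωL'
    have h1 := lt_of_mul_lt_mul_left hωU' hc.le
    have h2 := lt_of_mul_lt_mul_left hωL' hc.le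
    simp only [m] at h1 h2
    rw [abs_le]
    constructor <;> linarith

/-- With exponent `1/4` each sample contributes `(log 2)/2` to the log-Laplace transform, and `3/8 -
(log 2)/2 > 7/250`. -/
lemma IsMixedDesign.measure_sum_inner_sq_ge_le (hd : IsMixedDesign μ p₁ x z) (S : Finset (Fin N))
    {u : Vec k} (hu : ‖u‖ = 1) :
    μ.real {ω | 3 / 2 * S.card ≤ ∑ i ∈ S, (inner ℝ (x i ω) u : ℝ) ^ 2}
      ≤ Real.exp (-(7 / 250 * S.card)) := by
  have h := hd.measure_sum_ge_le S (f := fun v _ => 1 / 4 * (inner ℝ v u) ^ 2)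
    (fun _ => ((measurable_inner_right u).pow_const 2).const_mul _)
    (fun _ => integrable_exp_mul_inner_sq hu (by norm_num)) (A := Real.log 2 / 2)
    (by
      rw [integral_exp_mul_inner_sq hu (by norm_num), ← add_mul, add_sub_cancel, one_mul,
        show Real.log 2 / 2 = Real.log 2 * (1 / 2) by ring, ← Real.rpow_def_of_pos two_pos,
        ← Real.sqrt_eq_rpow, ← Real.sqrt_inv]
      norm_num)
    (1 / 4 * (3 / 2 * S.card))
  have e : {ω | 1 / 4 * (3 / 2 * (S.card : ℝ)) ≤ ∑ i ∈ S, 1 / 4 * (inner ℝ (x i ω) u : ℝ) ^ 2}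
      = {ω | 3 / 2 * (S.card : ℝ) ≤ ∑ i ∈ S, (inner ℝ (x i ω) u : ℝ) ^ 2} := by
    ext ω
    simp only [← Finset.mul_sum, Set.mem_ofPred_eq]
    constructor <;> intro h <;> linarith
  rw [e] at h
  refine h.trans (Real.exp_le_exp.2 ?_)
  have h2 := Real.log_two_lt_d9
  have h3 : (0 : ℝ) ≤ S.card := Nat.cast_nonneg _
  nlinarith

/-- Class `b` has mass at least `p`, so the Laplace transform of one sample is at most `1 - p/3 ≤
exp(-p/3)`; the rate is `1/3 - 4 · 2/25 = 1/75` times `p`. -/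
lemma IsMixedDesign.measure_sum_min_le_le (hd : IsMixedDesign μ p₁ x z) {p : ℝ} (hp : 0 ≤ p)
    (hp₁ : p ≤ p₁) (hp₂ : p ≤ 1 - p₁) (S : Finset (Fin N)) (b : Bool)
    {a a' : Vec k} (ha : ‖a‖ = 1) (ha' : ‖a'‖ = 1) :
    μ.real {ω | ∑ i ∈ S, (if z i ω = b then
        min ((inner ℝ (x i ω) a : ℝ) ^ 2) ((inner ℝ (x i ω) a') ^ 2) else 0)
          ≤ 2 / 25 * p * S.card}
      ≤ Real.exp (-(p / 75 * S.card)) := by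
  have key := integral_exp_neg_min_le ha ha'
  have hmeas : Measurable fun v : Vec k =>
    -4 * min ((inner ℝ v a : ℝ) ^ 2) ((inner ℝ v a') ^ 2) := by fun_prop
  let f : Vec k → Bool → ℝ := fun v c =>
    if c = b then -4 * min ((inner ℝ v a : ℝ) ^ 2) ((inner ℝ v a') ^ 2) else 0
  have hf : ∀ c, Measurable fun v => f v c := by
    intro c
    by_cases hc : c = b
    · simpa [f, hc] using hmeas
    · simp [f, hc]
  have h := hd.measure_sum_ge_le S hf (A := -p / 3)
    (fun c => by
      by_cases hc : c = b
      · simpa [f, hc] using key.1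
      · simp [f, hc])
    (by
      have h3 := Real.add_one_le_exp (-p / 3)
      have h2 := key.2
      have e1 : ∫ v, Real.exp (f v b) ∂(stdGaussian (Vec k)) ≤ 2 / 3 := by
        simpa [f] using h2
      have e2 : ∀ c, c ≠ b → ∫ v, Real.exp (f v c) ∂(stdGaussian (Vec k)) = 1 := by
        intro c hc
        simp [f, hc]
      cases b
      · rw [e2 true (by simp)]
        nlinarith
      · rw [e2 false (by simp)]
        nlinarith)
    (-4 * (2 / 25 * p * S.card))
  have e : {ω | -4 * (2 / 25 * p * S.card) ≤ ∑ i ∈ S, f (x i ω) (z i ω)}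
      = {ω | ∑ i ∈ S, (if z i ω = b then
        min ((inner ℝ (x i ω) a : ℝ) ^ 2) ((inner ℝ (x i ω) a') ^ 2) else 0)
          ≤ 2 / 25 * p * S.card} := by
    ext ω
    have : ∑ i ∈ S, f (x i ω) (z i ω) = -4 * ∑ i ∈ S, (if z i ω = b then
        min ((inner ℝ (x i ω) a : ℝ) ^ 2) ((inner ℝ (x i ω) a') ^ 2) else 0) := by
      rw [Finset.mul_sum]
      refine Finset.sum_congr rfl fun i _ => ?_
      simp only [f]
      split <;> simp
    simp only [this, Set.mem_ofPred_eq]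
    constructor <;> intro h <;> linarith
  rw [e] at h
  refine h.trans (Real.exp_le_exp.2 (le_of_eq ?_))
  ring

/-- On an event of large probability, the empirical second moments are at most `3 / 2` and the
empirical means of minima of squares within each class are bounded below, on a finite set. -/
lemma IsMixedDesign.exists_event_loss (hd : IsMixedDesign μ p₁ x z) {p : ℝ} (hp : 0 ≤ p)
    (hp₁ : p ≤ p₁) (hp₂ : p ≤ 1 - p₁) (S : Finset (Fin N))
    {T : Finset (Vec k)} (hT : ∀ t ∈ T, ‖t‖ = 1) :
    ∃ G : Set Ω, MeasurableSet G ∧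
      μ.real Gᶜ ≤ T.card * Real.exp (-(7 / 250 * S.card))
        + 2 * (T.card * (T.card * Real.exp (-(p / 75 * S.card)))) ∧
      ∀ ω ∈ G, (∀ u ∈ T, ∑ i ∈ S, (inner ℝ (x i ω) u : ℝ) ^ 2 ≤ 3 / 2 * S.card) ∧
        ∀ b, ∀ a ∈ T, ∀ a' ∈ T, 2 / 25 * p * S.card ≤ ∑ i ∈ S, (if z i ω = b then
          min ((inner ℝ (x i ω) a : ℝ) ^ 2) ((inner ℝ (x i ω) a') ^ 2) else 0) := by
  let D : Vec k → Set Ω := fun u => {ω | 3 / 2 * S.card ≤ ∑ i ∈ S, (inner ℝ (x i ω) u : ℝ) ^ 2}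
  let F : Bool → Vec k → Vec k → Set Ω := fun b a a' => {ω | ∑ i ∈ S, (if z i ω = b then
        min ((inner ℝ (x i ω) a : ℝ) ^ 2) ((inner ℝ (x i ω) a') ^ 2) else 0)
          ≤ 2 / 25 * p * S.card}
  have hDm : ∀ u, MeasurableSet (D u) := fun u => measurableSet_le measurable_const
    (hd.measurable_sum S (g := fun v _ => (inner ℝ v u : ℝ) ^ 2)
      fun _ => (measurable_inner_right u).pow_const 2)
  have hFm : ∀ b a a', MeasurableSet (F b a a') := fun b a a' => measurableSet_le
    (hd.measurable_sum S (g := fun v c => if c = b then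
        min ((inner ℝ v a : ℝ) ^ 2) ((inner ℝ v a') ^ 2) else 0)
      fun c => by
        by_cases hc : c = b
        · simp only [hc, if_true]; fun_prop
        · simp [hc]) measurable_const
  have hF : ∀ b, μ.real (⋃ a ∈ T, ⋃ a' ∈ T, F b a a')
      ≤ T.card * (T.card * Real.exp (-(p / 75 * S.card))) := by
    intro b
    refine (measureReal_biUnion_finset_le _ _).trans ?_
    rw [← nsmul_eq_mul]
    refine Finset.sum_le_card_nsmul _ _ _ fun a ha => (measureReal_biUnion_finset_le _ _).trans ?_
    rw [← nsmul_eq_mul]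
    exact Finset.sum_le_card_nsmul _ _ _ fun a' ha' =>
      hd.measure_sum_min_le_le hp hp₁ hp₂ S b (hT a ha) (hT a' ha')
  have hFmT : ∀ b, MeasurableSet (⋃ a ∈ T, ⋃ a' ∈ T, F b a a') := fun b =>
    T.measurableSet_biUnion fun a _ => T.measurableSet_biUnion fun a' _ => hFm b a a'
  refine ⟨((⋃ u ∈ T, D u) ∪ ((⋃ a ∈ T, ⋃ a' ∈ T, F true a a')
    ∪ (⋃ a ∈ T, ⋃ a' ∈ T, F false a a')))ᶜ, ?_, ?_, ?_⟩
  · exact ((T.measurableSet_biUnion fun u _ => hDm u).union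
      ((hFmT true).union (hFmT false))).compl
  · rw [compl_compl]
    refine (measureReal_union_le _ _).trans (add_le_add ?_ ?_)
    · refine (measureReal_biUnion_finset_le _ _).trans ?_
      rw [← nsmul_eq_mul]
      exact Finset.sum_le_card_nsmul _ _ _ fun u hu => hd.measure_sum_inner_sq_ge_le S (hT u hu)
    · exact (measureReal_union_le _ _).trans (by linarith [hF true, hF false])
  · intro ω hω
    simp only [Set.mem_compl_iff, Set.mem_union, Set.mem_iUnion, not_or, not_exists] at hω
    obtain ⟨hD, hFt, hFf⟩ := hω
    refine ⟨fun u hu => (not_le.1 (hD u hu)).le, fun b a ha a' ha' => ?_⟩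
    cases b
    · exact (not_le.1 (hFf a ha a' ha')).le
    · exact (not_le.1 (hFt a ha a' ha')).le

end Events

/-! ### Consequences of the events: all directions, the loss, and the error. -/

section Deterministic

variable {k N : ℕ}

lemma isSymmetric_momentOp (S : Finset (Fin N)) (x : Fin N → Vec k) (y : Fin N → ℝ) :
    (momentOp S x y).IsSymmetric := by
  intro a b
  simp [momentOp, inner_smul_left, inner_smul_right, sum_inner, inner_sum, real_inner_comm,
    mul_comm]

lemma inner_momentOp_self (S : Finset (Fin N)) (x : Fin N → Vec k) (y : Fin N → ℝ) (w : Vec k) :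
    inner ℝ (momentOp S x y w) w = (S.card : ℝ)⁻¹ * ∑ i ∈ S, y i ^ 2 * (inner ℝ (x i) w) ^ 2 := by
  simp [momentOp, inner_smul_left, sum_inner, pow_two, mul_assoc]

/-- Deviation of the moment operator from its mean, from its deviation on a net. -/
lemma momentOp_form_sub_le {S : Finset (Fin N)} (hS : 0 < S.card) {x : Fin N → Vec k}
    {y : Fin N → ℝ} {β₁ β₂ : Vec k} {p₁ p₂ ε η : ℝ} (hε : 0 ≤ ε) {T : Finset (Vec k)}
    (hT : ∀ t ∈ T, ‖t‖ = 1) (hη : η ≤ 1 / 4)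
    (hnet : ∀ u : Vec k, ‖u‖ = 1 → ∃ t ∈ T, ‖u - t‖ ≤ η)
    (h : ∀ w ∈ T, |∑ i ∈ S, y i ^ 2 * (inner ℝ (x i) w) ^ 2
      - S.card * (1 + 2 * (p₁ * (inner ℝ β₁ w) ^ 2 + p₂ * (inner ℝ β₂ w) ^ 2))| ≤ S.card * ε)
    (w : Vec k) :
    |inner ℝ (momentOp S x y w) w
      - (‖w‖ ^ 2 + 2 * (p₁ * (inner ℝ β₁ w) ^ 2 + p₂ * (inner ℝ β₂ w) ^ 2))|
      ≤ 2 * ε * ‖w‖ ^ 2 := by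
  have hS' : (0 : ℝ) < S.card := by exact_mod_cast hS
  let E : Vec k →L[ℝ] Vec k := ContinuousLinearMap.id ℝ (Vec k)
    + (2 : ℝ) • (p₁ • InnerProductSpace.rankOne ℝ β₁ β₁ + p₂ • InnerProductSpace.rankOne ℝ β₂ β₂)
  have hE : ∀ w, inner ℝ (E w) w
      = ‖w‖ ^ 2 + 2 * (p₁ * (inner ℝ β₁ w) ^ 2 + p₂ * (inner ℝ β₂ w) ^ 2) := by
    intro w
    simp [E, inner_add_left, inner_smul_left, pow_two, mul_add]
  have hEs : E.IsSymmetric := by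
    intro a b
    simp [E, inner_add_left, inner_add_right, inner_smul_left, inner_smul_right, real_inner_comm,
      mul_comm]
  have hD : (momentOp S x y - E).IsSymmetric := by
    intro a b
    have h1 := isSymmetric_momentOp S x y a b
    have h2 := hEs a b
    simp only [ContinuousLinearMap.coe_coe] at h1 h2 ⊢
    rw [sub_apply, sub_apply, inner_sub_left,
      inner_sub_right, h1, h2]
  have hDw : ∀ w, inner ℝ ((momentOp S x y - E) w) w = inner ℝ (momentOp S x y w) w
      - (‖w‖ ^ 2 + 2 * (p₁ * (inner ℝ β₁ w) ^ 2 + p₂ * (inner ℝ β₂ w) ^ 2)) := by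
    intro w
    rw [sub_apply, inner_sub_left, hE]
  have hnorm : ‖momentOp S x y - E‖ ≤ ε / (1 - 2 * η) := by
    refine norm_le_of_net hD (by linarith) hT hnet hε fun t ht => ?_
    rw [hDw, inner_momentOp_self, hT t ht]
    have := h t ht
    rw [← div_le_iff₀' hS', ← abs_of_pos hS', ← abs_div, abs_of_pos hS', sub_div,
      mul_div_cancel_left₀ _ hS'.ne', div_eq_inv_mul] at this
    simpa using this
  have hnorm2 : ‖momentOp S x y - E‖ ≤ 2 * ε := by
    refine hnorm.trans ?_
    rw [div_le_iff₀ (by linarith)]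
    nlinarith
  rw [← hDw]
  calc _ ≤ ‖(momentOp S x y - E) w‖ * ‖w‖ := abs_real_inner_le_norm _ _
    _ ≤ (2 * ε * ‖w‖) * ‖w‖ := by
      gcongr
      exact ((momentOp S x y - E).le_opNorm w).trans (by gcongr)
    _ = _ := by ring

lemma sum_inner_sq_le_of_net {S : Finset (Fin N)} {x : Fin N → Vec k} {η : ℝ}
    {T : Finset (Vec k)} (hT : ∀ t ∈ T, ‖t‖ = 1) (hη : η ≤ 1 / 8)
    (hnet : ∀ u : Vec k, ‖u‖ = 1 → ∃ t ∈ T, ‖u - t‖ ≤ η)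
    (h : ∀ u ∈ T, ∑ i ∈ S, (inner ℝ (x i) u : ℝ) ^ 2 ≤ 3 / 2 * S.card) (w : Vec k) :
    ∑ i ∈ S, (inner ℝ (x i) w : ℝ) ^ 2 ≤ 2 * S.card * ‖w‖ ^ 2 := by
  let D : Vec k →L[ℝ] Vec k := ∑ i ∈ S, InnerProductSpace.rankOne ℝ (x i) (x i)
  have hD : D.IsSymmetric := by
    intro a b
    simp [D, sum_inner, inner_sum, inner_smul_left, inner_smul_right, real_inner_comm, mul_comm]
  have hDw : ∀ w, inner ℝ (D w) w = ∑ i ∈ S, (inner ℝ (x i) w : ℝ) ^ 2 := by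
    intro w
    simp [D, sum_inner, inner_smul_left, pow_two]
  have hS : (0 : ℝ) ≤ S.card := Nat.cast_nonneg _
  have hnorm : ‖D‖ ≤ 3 / 2 * S.card / (1 - 2 * η) :=
    norm_le_of_net hD (by linarith) hT hnet (by positivity) fun t ht => by
      rw [hDw, abs_of_nonneg (Finset.sum_nonneg fun i _ => sq_nonneg _)]
      exact h t ht
  have hnorm2 : ‖D‖ ≤ 2 * S.card := by
    refine hnorm.trans ?_
    rw [div_le_iff₀ (by linarith)]
    nlinarith
  rw [← hDw]
  calc _ ≤ ‖D w‖ * ‖w‖ := real_inner_le_norm _ _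
    _ ≤ (2 * S.card * ‖w‖) * ‖w‖ := by
      gcongr
      exact (D.le_opNorm w).trans (by gcongr)
    _ = _ := by ring

/-- Follows from `s'² ≤ 2s² + 2(s - s')²` and its analogue for `t`. It carries lower bounds on
minima from a net to nearby directions. -/
lemma half_min_sq_sub_le (s t s' t' : ℝ) :
    min (s' ^ 2) (t' ^ 2) / 2 - ((s - s') ^ 2 + (t - t') ^ 2) ≤ min (s ^ 2) (t ^ 2) := by
  apply le_min
  · have := min_le_left (s' ^ 2) (t' ^ 2)
    nlinarith [sq_nonneg (2 * s - s'), sq_nonneg (t - t')]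
  · have := min_le_right (s' ^ 2) (t' ^ 2)
    nlinarith [sq_nonneg (2 * t - t'), sq_nonneg (s - s')]

/-- The mesh scales like `√p` because the lower bound to be preserved has order `p`: half of `2/25`,
minus two errors of `2/2500`, is `24/625`. -/
lemma sum_min_ge_of_net {S : Finset (Fin N)} {x : Fin N → Vec k} {z : Fin N → Bool} {b : Bool}
    {η p : ℝ} {T : Finset (Vec k)} (hηp : η ^ 2 = p / 2500)
    (hnet : ∀ u : Vec k, ‖u‖ = 1 → ∃ t ∈ T, ‖u - t‖ ≤ η)
    (hup : ∀ w, ∑ i ∈ S, (inner ℝ (x i) w : ℝ) ^ 2 ≤ 2 * S.card * ‖w‖ ^ 2)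
    (h : ∀ a ∈ T, ∀ a' ∈ T, 2 / 25 * p * S.card ≤ ∑ i ∈ S, (if z i = b then
      min ((inner ℝ (x i) a : ℝ) ^ 2) ((inner ℝ (x i) a') ^ 2) else 0))
    {a a' : Vec k} (ha : ‖a‖ = 1) (ha' : ‖a'‖ = 1) :
    24 / 625 * p * S.card ≤ ∑ i ∈ S, (if z i = b then
      min ((inner ℝ (x i) a : ℝ) ^ 2) ((inner ℝ (x i) a') ^ 2) else 0) := by
  obtain ⟨t, ht, hat⟩ := hnet a ha
  obtain ⟨t', ht', hat'⟩ := hnet a' ha'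
  have hS : (0 : ℝ) ≤ S.card := Nat.cast_nonneg _
  have key : (∑ i ∈ S, (if z i = b then
        min ((inner ℝ (x i) t : ℝ) ^ 2) ((inner ℝ (x i) t') ^ 2) else 0)) / 2
      - (∑ i ∈ S, (inner ℝ (x i) (a - t) : ℝ) ^ 2 + ∑ i ∈ S, (inner ℝ (x i) (a' - t') : ℝ) ^ 2)
      ≤ ∑ i ∈ S, (if z i = b then
        min ((inner ℝ (x i) a : ℝ) ^ 2) ((inner ℝ (x i) a') ^ 2) else 0) := by
    rw [Finset.sum_div, ← Finset.sum_add_distrib, ← Finset.sum_sub_distrib]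
    refine Finset.sum_le_sum fun i _ => ?_
    rw [inner_sub_right, inner_sub_right]
    split
    · exact half_min_sq_sub_le _ _ _ _
    · nlinarith [sq_nonneg ((inner ℝ (x i) a : ℝ) - inner ℝ (x i) t),
        sq_nonneg ((inner ℝ (x i) a' : ℝ) - inner ℝ (x i) t')]
  have bound : ∀ v : Vec k, ‖v‖ ≤ η →
      ∑ i ∈ S, (inner ℝ (x i) v : ℝ) ^ 2 ≤ 2 * S.card * (p / 2500) := by
    intro v hv
    refine (hup v).trans ?_
    rw [← hηp]
    gcongr
  linarith [h t ht t' ht', bound _ hat, bound _ hat']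

lemma sum_min_ge_of_le_norm {S : Finset (Fin N)} {x : Fin N → Vec k} {z : Fin N → Bool} {b : Bool}
    {q : ℝ} (h : ∀ a a' : Vec k, ‖a‖ = 1 → ‖a'‖ = 1 → q ≤ ∑ i ∈ S, (if z i = b then
      min ((inner ℝ (x i) a : ℝ) ^ 2) ((inner ℝ (x i) a') ^ 2) else 0))
    {a a' : Vec k} {m : ℝ} (hm : 0 ≤ m) (ha : m ≤ ‖a‖) (ha' : m ≤ ‖a'‖) :
    q * m ^ 2 ≤ ∑ i ∈ S, (if z i = b then
      min ((inner ℝ (x i) a : ℝ) ^ 2) ((inner ℝ (x i) a') ^ 2) else 0) := by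
  rcases hm.eq_or_lt with rfl | hm
  · rw [zero_pow two_ne_zero, mul_zero]
    refine Finset.sum_nonneg fun i _ => ?_
    split
    · positivity
    · rfl
  have ha0 : 0 < ‖a‖ := hm.trans_le ha
  have ha0' : 0 < ‖a'‖ := hm.trans_le ha'
  have hn : ‖(‖a‖⁻¹ • a)‖ = 1 := by rw [norm_smul, norm_inv, norm_norm, inv_mul_cancel₀ ha0.ne']
  have hn' : ‖(‖a'‖⁻¹ • a')‖ = 1 := by
    rw [norm_smul, norm_inv, norm_norm, inv_mul_cancel₀ ha0'.ne']
  refine (mul_le_mul_of_nonneg_right (h _ _ hn hn') (sq_nonneg m)).trans ?_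
  rw [Finset.sum_mul]
  refine Finset.sum_le_sum fun i _ => ?_
  have scale : ∀ v : Vec k, 0 < ‖v‖ → m ≤ ‖v‖ →
      (inner ℝ (x i) (‖v‖⁻¹ • v) : ℝ) ^ 2 * m ^ 2 ≤ (inner ℝ (x i) v) ^ 2 := by
    intro v hv hmv
    rw [inner_smul_right, ← mul_pow]
    have e : ‖v‖⁻¹ * inner ℝ (x i) v * m = inner ℝ (x i) v * (m / ‖v‖) := by field_simp
    rw [e, mul_pow]
    have h1 : m / ‖v‖ ≤ 1 := (div_le_one hv).2 hmv
    have h2 : (m / ‖v‖) ^ 2 ≤ 1 := pow_le_one₀ (by positivity) h1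
    nlinarith [sq_nonneg (inner ℝ (x i) v : ℝ)]
  split
  · apply le_min
    · exact (mul_le_mul_of_nonneg_right (min_le_left _ _) (sq_nonneg m)).trans (scale a ha0 ha)
    · exact (mul_le_mul_of_nonneg_right (min_le_right _ _) (sq_nonneg m)).trans
        (scale a' ha0' ha')
  · simp

/-- Bound each minimum by the residual of the regressor that generated the sample. -/
lemma loss_le {S : Finset (Fin N)} {x : Fin N → Vec k} {z : Fin N → Bool} {β₁ β₂ : Vec k}
    (hup : ∀ w, ∑ i ∈ S, (inner ℝ (x i) w : ℝ) ^ 2 ≤ 2 * S.card * ‖w‖ ^ 2) {u₁ u₂ : Vec k} {r : ℝ}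
    (h₁ : ‖u₁ - β₁‖ ≤ r) (h₂ : ‖u₂ - β₂‖ ≤ r) :
    loss S x (fun i => response β₁ β₂ (x i) (z i)) u₁ u₂ ≤ 4 * S.card * r ^ 2 := by
  have b1 : ∑ i ∈ S, (inner ℝ (x i) (u₁ - β₁) : ℝ) ^ 2 ≤ 2 * S.card * r ^ 2 :=
    (hup _).trans (by gcongr)
  have b2 : ∑ i ∈ S, (inner ℝ (x i) (u₂ - β₂) : ℝ) ^ 2 ≤ 2 * S.card * r ^ 2 :=
    (hup _).trans (by gcongr)
  have key : loss S x (fun i => response β₁ β₂ (x i) (z i)) u₁ u₂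
      ≤ ∑ i ∈ S, (inner ℝ (x i) (u₁ - β₁) : ℝ) ^ 2 + ∑ i ∈ S, (inner ℝ (x i) (u₂ - β₂) : ℝ) ^ 2 := by
    rw [loss, ← Finset.sum_add_distrib]
    refine Finset.sum_le_sum fun i _ => ?_
    rw [inner_sub_right, inner_sub_right]
    cases hz : z i
    · refine (min_le_right _ _).trans ?_
      simp only [response, Bool.false_eq_true, if_false]
      nlinarith [sq_nonneg ((inner ℝ (x i) u₁ : ℝ) - inner ℝ (x i) β₁)]
    · refine (min_le_left _ _).trans ?_
      simp only [response, if_true]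
      nlinarith [sq_nonneg ((inner ℝ (x i) u₂ : ℝ) - inner ℝ (x i) β₂)]
  linarith

/-- On class `b` the two residuals are exactly these inner products; the nonnegative terms of the
other class are dropped. -/
lemma sum_min_le_loss (S : Finset (Fin N)) (x : Fin N → Vec k) (z : Fin N → Bool)
    (β₁ β₂ b₁ b₂ : Vec k) (b : Bool) :
    ∑ i ∈ S, (if z i = b then min ((inner ℝ (x i) ((if b then β₁ else β₂) - b₁) : ℝ) ^ 2)
        ((inner ℝ (x i) ((if b then β₁ else β₂) - b₂)) ^ 2) else 0)
      ≤ loss S x (fun i => response β₁ β₂ (x i) (z i)) b₁ b₂ := by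
  refine Finset.sum_le_sum fun i _ => ?_
  split
  · next hz =>
    rw [inner_sub_right, inner_sub_right]
    simp only [hz]
    cases b <;> simp [response]
  · positivity

/-- If each `β_j` is close to `b₁` or `b₂`, then the two are matched. -/
lemma min_err_le {β₁ β₂ b₁ b₂ : Vec k} {r : ℝ} (hr : 2 * r < ‖β₁ - β₂‖)
    (h₁ : min ‖β₁ - b₁‖ ‖β₁ - b₂‖ ≤ r) (h₂ : min ‖β₂ - b₁‖ ‖β₂ - b₂‖ ≤ r) :
    min (err β₁ β₂ b₁ b₂) (err β₁ β₂ b₂ b₁) ≤ r := by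
  have far : ∀ b : Vec k, ‖β₁ - b‖ ≤ r → ‖β₂ - b‖ ≤ r → False := by
    intro b hb₁ hb₂
    have := norm_sub_le_norm_sub_add_norm_sub β₁ b β₂
    rw [norm_sub_rev b β₂] at this
    linarith
  rw [min_le_iff] at h₁ h₂ ⊢
  simp only [err, max_le_iff]
  rw [norm_sub_rev b₁ β₁, norm_sub_rev b₂ β₂, norm_sub_rev b₂ β₁, norm_sub_rev b₁ β₂]
  rcases h₁ with h₁ | h₁ <;> rcases h₂ with h₂ | h₂
  · exact (far _ h₁ h₂).elim
  · exact Or.inl ⟨h₁, h₂⟩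
  · exact Or.inr ⟨h₁, h₂⟩
  · exact (far _ h₁ h₂).elim

/-- A pair whose loss does not exceed that of a good pair is close to `β₁, β₂` up to a swap. -/
lemma min_err_le_of_loss_le {S : Finset (Fin N)} (hS : 0 < S.card) {x : Fin N → Vec k}
    {z : Fin N → Bool} {β₁ β₂ : Vec k} {p δ chat : ℝ} (hp : 0 < p) (hp2 : p ≤ 1 / 2)
    (hδ : 0 < δ) (hchat0 : 0 < chat) (hchat : chat < 1 / 2)
    (hδle : δ ≤ 2 / 11 * chat * ‖β₁ - β₂‖ * Real.sqrt p ^ 3)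
    (hup : ∀ w, ∑ i ∈ S, (inner ℝ (x i) w : ℝ) ^ 2 ≤ 2 * S.card * ‖w‖ ^ 2)
    (hlo : ∀ b, ∀ a a' : Vec k, ‖a‖ = 1 → ‖a'‖ = 1 →
      24 / 625 * p * S.card ≤ ∑ i ∈ S, (if z i = b then
        min ((inner ℝ (x i) a : ℝ) ^ 2) ((inner ℝ (x i) a') ^ 2) else 0))
    {u₁ u₂ b₁ b₂ : Vec k} (hu₁ : ‖u₁ - β₁‖ ≤ 51 / 100 * δ) (hu₂ : ‖u₂ - β₂‖ ≤ 51 / 100 * δ)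
    (hloss : loss S x (fun i => response β₁ β₂ (x i) (z i)) b₁ b₂
      ≤ loss S x (fun i => response β₁ β₂ (x i) (z i)) u₁ u₂) :
    min (err β₁ β₂ b₁ b₂) (err β₁ β₂ b₂ b₁) ≤ chat * p * ‖β₁ - β₂‖ := by
  have hS' : (0 : ℝ) < S.card := by exact_mod_cast hS
  have hloss' := hloss.trans (loss_le hup hu₁ hu₂)
  have hΔ : 0 < ‖β₁ - β₂‖ := by
    refine lt_of_le_of_ne (norm_nonneg _) fun h => ?_
    rw [← h] at hδle
    linarith
  have hsq : Real.sqrt p ^ 2 = p := Real.sq_sqrt hp.le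
  have hδ2 : 121 / 4 * δ ^ 2 ≤ p * (chat * p * ‖β₁ - β₂‖) ^ 2 := by
    have h1 : δ ^ 2 ≤ (2 / 11 * chat * ‖β₁ - β₂‖ * Real.sqrt p ^ 3) ^ 2 := by gcongr
    have h2 : (2 / 11 * chat * ‖β₁ - β₂‖ * Real.sqrt p ^ 3) ^ 2
        = 4 / 121 * (p * (chat * p * ‖β₁ - β₂‖) ^ 2) := by
      rw [mul_pow, ← pow_mul, show 3 * 2 = 2 * 3 by norm_num, pow_mul, hsq]
      ring
    linarith
  have main : ∀ b : Bool, min ‖(if b then β₁ else β₂) - b₁‖ ‖(if b then β₁ else β₂) - b₂‖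
      ≤ chat * p * ‖β₁ - β₂‖ := by
    intro b
    set m := min ‖(if b then β₁ else β₂) - b₁‖ ‖(if b then β₁ else β₂) - b₂‖ with hm
    have h1 := sum_min_ge_of_le_norm (hlo b) (m := m) (by positivity) (min_le_left _ _)
      (min_le_right _ _)
    have h2 := (h1.trans (sum_min_le_loss S x z β₁ β₂ b₁ b₂ b)).trans hloss'
    have h3 : 24 / 625 * p * m ^ 2 ≤ 4 * (51 / 100 * δ) ^ 2 := by
      refine le_of_mul_le_mul_right ?_ hS'
      linarith
    -- Here `4 · (51/100)² · 625/24 < 121/4`, so the constant in the hypothesis on `δ` suffices.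
    have h4 : p * m ^ 2 ≤ p * (chat * p * ‖β₁ - β₂‖) ^ 2 := by nlinarith [sq_nonneg δ]
    exact le_of_sq_le_sq (le_of_mul_le_mul_left h4 hp) (by positivity)
  refine min_err_le ?_ (by simpa using main true) (by simpa using main false)
  have : chat * p < 1 / 2 := by nlinarith
  nlinarith

lemma exists_isInitOutput (hk : 2 ≤ k) (δ : ℝ) (Sstar Splus : Finset (Fin N)) (x : Fin N → Vec k)
    (y : Fin N → ℝ) : ∃ b₁ b₂, IsInitOutput δ Sstar Splus x y b₁ b₂ := by
  obtain ⟨v₁, v₂, hv⟩ := exists_isTopTwo (isSymmetric_momentOp Sstar x y) hk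
  have hfin : (grid δ v₁ v₂).Finite := by
    refine ((Set.finite_Iic ⌈2 * Real.pi / δ⌉₊).image fun t : ℕ =>
      Real.cos (δ * t) • v₁ + Real.sin (δ * t) • v₂).subset ?_
    rintro u ⟨t, ht, rfl⟩
    exact ⟨t, ht, rfl⟩
  have hne : (grid δ v₁ v₂).Nonempty := ⟨_, 0, Nat.zero_le _, rfl⟩
  obtain ⟨⟨b₁, b₂⟩, ⟨hb₁, hb₂⟩, hmin⟩ := Set.exists_min_image (grid δ v₁ v₂ ×ˢ grid δ v₁ v₂)
    (fun q => loss Splus x y q.1 q.2) (hfin.prod hfin) (hne.prod hne)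
  exact ⟨b₁, b₂, v₁, v₂, hv, hb₁, hb₂, fun u₁ h₁ u₂ h₂ => hmin (u₁, u₂) ⟨h₁, h₂⟩⟩

end Deterministic

/-! ### Elementary estimates for the sample size. -/

section Arithmetic

lemma exp_neg_le_two_div_sq {k : ℕ} (hk : 0 < k) : Real.exp (-(k : ℝ)) ≤ 2 / (k : ℝ) ^ 2 := by
  have hk' : (0 : ℝ) < k := by exact_mod_cast hk
  have h := Real.quadratic_le_exp_of_nonneg hk'.le
  rw [Real.exp_neg, inv_eq_one_div, div_le_div_iff₀ (Real.exp_pos _) (by positivity)]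
  linarith

lemma half_le_log {k : ℕ} (hk : 2 ≤ k) : (1 : ℝ) / 2 ≤ Real.log k := by
  have h1 : Real.log 2 ≤ Real.log k := Real.log_le_log two_pos (by exact_mod_cast hk)
  linarith [Real.log_two_gt_d9]

lemma log_le_two_mul_sqrt {r : ℝ} (hr : 0 < r) : Real.log r ≤ 2 * Real.sqrt r := by
  have h := Real.log_le_sub_one_of_pos (Real.sqrt_pos.2 hr)
  rw [Real.log_sqrt hr.le] at h
  linarith

/-- The sample size `10⁷ R² k log² k / ε²` dominates the quantities needed for concentration. -/
lemma sample_size_bounds {k : ℕ} (hk : 2 ≤ k) {R ε n : ℝ} (hR : 1 ≤ R) (hε0 : 0 < ε) (hε1 : ε ≤ 1)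
    (hn : 10 ^ 7 * R ^ 2 * k * Real.log k ^ 2 / ε ^ 2 ≤ n) :
    (k : ℝ) ≤ n ∧ 4 * 524288 * R * k ≤ n * ε ^ 2 ∧ 192 * R * k * Real.log n ≤ n * ε := by
  have hk' : (2 : ℝ) ≤ k := by exact_mod_cast hk
  have hk0 : (0 : ℝ) < k := by linarith
  have hl := half_le_log hk
  set ℓ := Real.log k
  have hl2 : 1 / 2 * ℓ ≤ ℓ ^ 2 := by nlinarith
  have hR2 : R ≤ R ^ 2 := by nlinarith
  rw [div_le_iff₀ (by positivity)] at hn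
  have hRk : 0 < R * k := by positivity
  have h0 : R * k ≤ R ^ 2 * k := by gcongr
  have hA : 10 ^ 7 / 2 * (R * k) * ℓ ≤ n * ε ^ 2 := by
    calc 10 ^ 7 / 2 * (R * k) * ℓ = 10 ^ 7 * (R * k) * (1 / 2 * ℓ) := by ring
      _ ≤ 10 ^ 7 * (R ^ 2 * k) * ℓ ^ 2 := by gcongr
      _ = 10 ^ 7 * R ^ 2 * k * ℓ ^ 2 := by ring
      _ ≤ _ := hn
  have hB : 10 ^ 7 / 4 * (R ^ 2 * k) ≤ n * ε ^ 2 := by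
    calc 10 ^ 7 / 4 * (R ^ 2 * k) = 10 ^ 7 * (R ^ 2 * k) * (1 / 2) ^ 2 := by ring
      _ ≤ 10 ^ 7 * (R ^ 2 * k) * ℓ ^ 2 := by gcongr
      _ = 10 ^ 7 * R ^ 2 * k * ℓ ^ 2 := by ring
      _ ≤ _ := hn
  have hnpos : 0 < n := by
    have : 0 < n * ε ^ 2 := lt_of_lt_of_le (by positivity) hB
    exact pos_of_mul_pos_left this (by positivity)
  have hε2 : ε ^ 2 ≤ ε := by nlinarith
  have hnε : n * ε ^ 2 ≤ n * ε := by gcongr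
  have hnε' : n * ε ≤ n := by nlinarith
  refine ⟨by nlinarith, by nlinarith, ?_⟩
  -- Splitting `log n = log r + log k`, the first part is absorbed through `log r ≤ 2√r` and the
  -- lower bound on `√r · ε`, the second by the factor `log² k` in the sample size.
  set r := n / k with hr
  have hrpos : 0 < r := by positivity
  have hnr : n = r * k := by rw [hr]; field_simp
  have hlog : Real.log n = Real.log r + ℓ := by
    rw [hnr, Real.log_mul hrpos.ne' hk0.ne']
  have hs2 : Real.sqrt r ^ 2 = r := Real.sq_sqrt hrpos.le
  have hrB : 10 ^ 7 / 4 * R ^ 2 ≤ (Real.sqrt r * ε) ^ 2 := by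
    rw [mul_pow, hs2]
    refine le_of_mul_le_mul_right ?_ hk0
    rw [hnr] at hB
    linarith
  have hsε : 1536 / 2 * R ≤ Real.sqrt r * ε := by
    refine le_of_sq_le_sq (le_trans ?_ hrB) (by positivity)
    nlinarith [sq_nonneg R]
  have hlr : 384 * R * Real.log r ≤ r * ε := by
    calc 384 * R * Real.log r ≤ 384 * R * (2 * Real.sqrt r) := by
          gcongr; exact log_le_two_mul_sqrt hrpos
      _ = Real.sqrt r * (1536 / 2 * R) := by ring
      _ ≤ Real.sqrt r * (Real.sqrt r * ε) := by gcongr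
      _ = r * ε := by rw [← mul_assoc, ← pow_two, hs2]
  have h1 : 384 * R * Real.log r * k ≤ n * ε := by
    rw [hnr]
    calc 384 * R * Real.log r * k ≤ r * ε * k := by gcongr
      _ = r * k * ε := by ring
  rw [hlog]
  have h2 : 384 * (R * k) * ℓ ≤ n * ε := by nlinarith
  linarith

end Arithmetic

/-! ### Sample sizes turned into probabilities of order `k⁻²`. -/

section Assembly

variable {k N : ℕ} {Ω : Type*} [MeasurableSpace Ω] {μ : Measure Ω} [IsProbabilityMeasure μ]
  {p₁ : ℝ} {x : Fin N → Ω → Vec k} {z : Fin N → Ω → Bool}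

lemma two_le_of_ne {β₁ β₂ : Vec k} (hβ₁ : ‖β₁‖ = 1) (hβ₂ : ‖β₂‖ = 1) (hne : β₁ ≠ β₂)
    (hne' : β₁ ≠ -β₂) : 2 ≤ k := by
  by_contra! hk
  interval_cases k
  · exact hne (Subsingleton.elim _ _)
  · have e : ∀ v : Vec 1, ‖v‖ = |v 0| := fun v => by
      simp [EuclideanSpace.norm_eq, Real.sqrt_sq_eq_abs]
    rw [e] at hβ₁ hβ₂
    rcases abs_eq_abs.1 (hβ₁.trans hβ₂.symm) with h | h
    · exact hne (by ext i; rw [Subsingleton.elim i 0]; exact h)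
    · exact hne' (by ext i; rw [Subsingleton.elim i 0]; simpa using h)

/-- Distinct, non-opposite unit vectors have `ρ² < 1`, so the square root is strictly below 1. The
upper bound turns the hypothesis on the sample size into one in terms of `δ²`. -/
lemma deltaTilde_pos_and_le {β₁ β₂ : Vec k} (hβ₁ : ‖β₁‖ = 1) (hβ₂ : ‖β₂‖ = 1) (hne : β₁ ≠ β₂)
    (hne' : β₁ ≠ -β₂) {p₁ p₂ δ : ℝ} (hp₁ : 0 < p₁) (hp₂ : 0 < p₂) (hδ : 0 < δ) :
    0 < deltaTilde δ p₁ p₂ β₁ β₂ ∧ deltaTilde δ p₁ p₂ β₁ β₂ ≤ δ ^ 2 := by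
  set ρ : ℝ := inner ℝ β₁ β₂ with hρ
  have h1 : 0 < 1 - ρ := by
    have := norm_sub_sq_real β₁ β₂
    rw [hβ₁, hβ₂, ← hρ] at this
    have hpos : 0 < ‖β₁ - β₂‖ ^ 2 := by
      have := norm_pos_iff.2 (sub_ne_zero.2 hne)
      positivity
    linarith
  have h2 : 0 < 1 + ρ := by
    have := norm_add_sq_real β₁ β₂
    rw [hβ₁, hβ₂, ← hρ] at this
    have hpos : 0 < ‖β₁ + β₂‖ ^ 2 := by
      have := norm_pos_iff.2 (fun h => hne' (eq_neg_of_add_eq_zero_left h))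
      positivity
    linarith
  have h3 : 0 < 4 * (1 - ρ ^ 2) * p₁ * p₂ := by
    have : 0 < 1 - ρ ^ 2 := by nlinarith
    positivity
  have h4 : Real.sqrt (1 - 4 * (1 - ρ ^ 2) * p₁ * p₂) < 1 := by
    rw [Real.sqrt_lt' one_pos]
    linarith
  have h5 := Real.sqrt_nonneg (1 - 4 * (1 - ρ ^ 2) * p₁ * p₂)
  rw [deltaTilde, ← hρ]
  have hd : 0 < δ ^ 2 := by positivity
  constructor
  · have : 0 < 1 - Real.sqrt (1 - 4 * (1 - ρ ^ 2) * p₁ * p₂) := by linarith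
    positivity
  · nlinarith

/-- Every grid produced from a moment operator close to its mean contains points near `β₁, β₂`. -/
lemma IsTopTwo.exists_mem_grid_near {M : Vec k →L[ℝ] Vec k} (hM : M.IsSymmetric)
    {v₁ v₂ β₁ β₂ : Vec k} (hv : IsTopTwo M v₁ v₂) {p₁ p₂ p δ ε : ℝ} (hp : 0 < p) (hp₁ : p ≤ p₁)
    (hp₂ : p ≤ p₂) (hδ : 0 < δ) (hε : ε = p * δ ^ 2 / 40000)
    (hβ₁ : ‖β₁‖ = 1) (hβ₂ : ‖β₂‖ = 1)
    (h : ∀ w, |inner ℝ (M w) w - (‖w‖ ^ 2 + 2 * (p₁ * (inner ℝ β₁ w) ^ 2 + p₂ * (inner ℝ β₂ w) ^ 2))|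
      ≤ 2 * ε * ‖w‖ ^ 2) :
    (∃ u ∈ grid δ v₁ v₂, ‖u - β₁‖ ≤ 51 / 100 * δ) ∧
      ∃ u ∈ grid δ v₁ v₂, ‖u - β₂‖ ≤ 51 / 100 * δ := by
  have hε0 : 0 ≤ 2 * ε := by rw [hε]; positivity
  have near : ∀ u : Vec k, ‖u‖ = 1 →
      (∀ w, p * (inner ℝ u w) ^ 2 ≤ p₁ * (inner ℝ β₁ w) ^ 2 + p₂ * (inner ℝ β₂ w) ^ 2) →
      ∃ g ∈ grid δ v₁ v₂, ‖g - u‖ ≤ 51 / 100 * δ := by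
    intro u hu hdom
    have hproj := hv.mul_norm_sub_proj_sq_le hM h hε0 u hdom
    -- With this `e`, `√(2e) = δ/100`, which with the rounding error `δ/2` makes `51/100 · δ`.
    obtain ⟨g, hg, hgu⟩ := MixedRegression.exists_mem_grid_near hv.1 hv.2.1 hv.2.2.1 hu hδ
      (e := δ ^ 2 / 20000) (by
        refine le_of_mul_le_mul_left (hproj.trans (le_of_eq ?_)) hp
        rw [hε]; ring)
    refine ⟨g, hg, hgu.trans (le_of_eq ?_)⟩
    rw [show 2 * (δ ^ 2 / 20000) = (δ / 100) ^ 2 by ring, Real.sqrt_sq (by positivity)]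
    ring
  refine ⟨near β₁ hβ₁ fun w => ?_, near β₂ hβ₂ fun w => ?_⟩
  · nlinarith [sq_nonneg (inner ℝ β₁ w : ℝ), sq_nonneg (inner ℝ β₂ w : ℝ)]
  · nlinarith [sq_nonneg (inner ℝ β₁ w : ℝ), sq_nonneg (inner ℝ β₂ w : ℝ)]

/-- In `R = log L + 1` the logarithm pays for the union bound over the net and the 1 leaves
`exp(-k)`. -/
lemma net_card_mul_exp_le {T : Finset (Vec k)} {L R s : ℝ} (hL : 0 < L) (hT : (T.card : ℝ) ≤ L ^ k)
    (hR : R = Real.log L + 1) (hs : R * k ≤ s) : T.card * Real.exp (-s) ≤ Real.exp (-(k : ℝ)) := by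
  have e : L ^ k = Real.exp (k * Real.log L) := by
    rw [Real.exp_nat_mul, Real.exp_log hL]
  calc T.card * Real.exp (-s) ≤ Real.exp (k * Real.log L) * Real.exp (-s) := by
        rw [← e]; gcongr
    _ = Real.exp (k * Real.log L + -s) := (Real.exp_add _ _).symm
    _ ≤ Real.exp (-(k : ℝ)) := Real.exp_le_exp.2 (by rw [hR] at hs; linarith)

/-- The moment event with its probability made explicit. -/
lemma IsMixedDesign.exists_event_moment_of_card (hd : IsMixedDesign μ p₁ x z) (hp₀ : 0 ≤ p₁)
    (hp₁ : p₁ ≤ 1) (hk : 2 ≤ k) {β₁ β₂ : Vec k} (hβ₁ : ‖β₁‖ = 1) (hβ₂ : ‖β₂‖ = 1)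
    (S : Finset (Fin N)) {T : Finset (Vec k)} (hT : ∀ t ∈ T, ‖t‖ = 1) {L R ε : ℝ} (hL : 1 ≤ L)
    (hTL : (T.card : ℝ) ≤ L ^ k) (hR : R = Real.log L + 1) (hε0 : 0 < ε) (hε1 : ε ≤ 1)
    (hS : 10 ^ 7 * R ^ 2 * k * Real.log k ^ 2 / ε ^ 2 ≤ (S.card : ℝ)) :
    0 < S.card ∧ ∃ G : Set Ω, MeasurableSet G ∧ μ.real Gᶜ ≤ 6 / (k : ℝ) ^ 2 ∧
      ∀ ω ∈ G, ∀ w ∈ T,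
        |∑ i ∈ S, response β₁ β₂ (x i ω) (z i ω) ^ 2 * (inner ℝ (x i ω) w) ^ 2
          - S.card * (1 + 2 * (p₁ * (inner ℝ β₁ w) ^ 2 + (1 - p₁) * (inner ℝ β₂ w) ^ 2))|
          ≤ S.card * ε := by
  have hR1 : 1 ≤ R := by rw [hR]; linarith [Real.log_nonneg hL]
  obtain ⟨hkn, hn1, hn2⟩ := sample_size_bounds hk hR1 hε0 hε1 hS
  set n : ℝ := (S.card : ℝ) with hn
  have hk' : (2 : ℝ) ≤ k := by exact_mod_cast hk
  have hnpos : 0 < n := by linarith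
  have hlog : 0 < Real.log n := Real.log_pos (by linarith)
  -- Makes `exp(-τ/4) = n⁻³`, so the union over `n` samples costs `2/n² ≤ 2/k²`.
  set τ := 12 * Real.log n with hτ
  have hτpos : 0 < τ := by positivity
  set c := min (ε / (2 * 524288)) (1 / (8 * τ)) with hc
  have hcpos : 0 < c := lt_min (by positivity) (by positivity)
  obtain ⟨G, hG, hGμ, hGω⟩ := hd.exists_event_moment hp₀ hp₁ hβ₁ hβ₂ S hT (ε := ε) hcpos hτpos.le
    (by
      calc c * τ ≤ 1 / (8 * τ) * τ := by gcongr; exact min_le_right _ _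
        _ = 1 / 8 := by field_simp)
    (by
      calc c * 524288 ≤ ε / (2 * 524288) * 524288 := by gcongr; exact min_le_left _ _
        _ = ε / 2 := by ring)
  refine ⟨Nat.cast_pos.1 hnpos, G, hG, hGμ.trans ?_, hGω⟩
  rw [← hn]
  have hA : n * (2 * Real.exp (-τ / 4)) ≤ 2 / (k : ℝ) ^ 2 := by
    have e : Real.exp (-τ / 4) = (n ^ 3)⁻¹ := by
      rw [hτ, show -(12 * Real.log n) / 4 = -((3 : ℕ) * Real.log n) by push_cast; ring,
        Real.exp_neg, Real.exp_nat_mul, Real.exp_log hnpos]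
    rw [e]
    calc n * (2 * (n ^ 3)⁻¹) = 2 / n ^ 2 := by field_simp
      _ ≤ 2 / (k : ℝ) ^ 2 := by gcongr
  have hcn : R * k ≤ n * (c * ε / 2) := by
    have : R * k * 2 / (n * ε) ≤ c := by
      apply le_min
      · rw [div_le_div_iff₀ (by positivity) (by positivity)]
        linarith
      · rw [div_le_div_iff₀ (by positivity) (by positivity), hτ]
        linarith
    rw [div_le_iff₀ (by positivity)] at this
    linarith
  have hB := net_card_mul_exp_le (by linarith) hTL hR hcn
  have hC := exp_neg_le_two_div_sq (show 0 < k by omega)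
  have e6 : (6 : ℝ) / (k : ℝ) ^ 2 = 2 / (k : ℝ) ^ 2 + 2 * (2 / (k : ℝ) ^ 2) := by ring
  rw [e6]
  linarith

/-- The loss event with its probability made explicit. -/
lemma IsMixedDesign.exists_event_loss_of_card (hd : IsMixedDesign μ p₁ x z) (hk : 0 < k) {p : ℝ}
    (hp : 0 < p) (hp₁ : p ≤ p₁) (hp₂ : p ≤ 1 - p₁) (S : Finset (Fin N))
    {T : Finset (Vec k)} (hT : ∀ t ∈ T, ‖t‖ = 1) {L R : ℝ} (hL : 1 ≤ L)
    (hTL : (T.card : ℝ) ≤ L ^ k) (hR : R = Real.log L + 1)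
    (hS : 150 * R / p * k ≤ (S.card : ℝ)) :
    0 < S.card ∧ ∃ G : Set Ω, MeasurableSet G ∧ μ.real Gᶜ ≤ 6 / (k : ℝ) ^ 2 ∧
      ∀ ω ∈ G, (∀ u ∈ T, ∑ i ∈ S, (inner ℝ (x i ω) u : ℝ) ^ 2 ≤ 3 / 2 * S.card) ∧
        ∀ b, ∀ a ∈ T, ∀ a' ∈ T, 2 / 25 * p * S.card ≤ ∑ i ∈ S, (if z i ω = b then
          min ((inner ℝ (x i ω) a : ℝ) ^ 2) ((inner ℝ (x i ω) a') ^ 2) else 0) := by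
  have hR1 : 1 ≤ R := by rw [hR]; linarith [Real.log_nonneg hL]
  have hk' : (0 : ℝ) < k := by exact_mod_cast hk
  have hnp : 150 * R * k ≤ p * S.card := by
    rw [div_mul_eq_mul_div, div_le_iff₀ hp] at hS
    linarith
  have hRk : 0 < R * k := by positivity
  have hnpos : (0 : ℝ) < S.card := by
    have : 0 < p * (S.card : ℝ) := by linarith
    exact pos_of_mul_pos_right this hp.le
  have hn : 150 * R * k ≤ S.card := by nlinarith
  obtain ⟨G, hG, hGμ, hGω⟩ := hd.exists_event_loss hp.le hp₁ hp₂ S hT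
  refine ⟨Nat.cast_pos.1 hnpos, G, hG, hGμ.trans ?_, hGω⟩
  have hA := net_card_mul_exp_le (by linarith) hTL hR
    (show R * k ≤ 7 / 250 * (S.card : ℝ) by linarith)
  have hB := net_card_mul_exp_le (by linarith) hTL hR
    (show R * k ≤ p / 150 * (S.card : ℝ) by linarith)
  -- The union runs over pairs of net points, so the exponent is split in two and the one-net bound
  -- is squared.
  have hB2 : T.card * (T.card * Real.exp (-(p / 75 * S.card))) ≤ Real.exp (-(k : ℝ)) := by
    have e : T.card * (T.card * Real.exp (-(p / 75 * S.card)))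
        = (T.card * Real.exp (-(p / 150 * S.card))) ^ 2 := by
      rw [mul_pow, ← Real.exp_nat_mul]
      ring_nf
    rw [e]
    have h1 : Real.exp (-(k : ℝ)) ≤ 1 := Real.exp_le_one_iff.2 (by linarith)
    have h0 : 0 ≤ T.card * Real.exp (-(p / 150 * S.card)) := by positivity
    nlinarith
  have hC := exp_neg_le_two_div_sq hk
  have e6 : (6 : ℝ) / (k : ℝ) ^ 2 = 3 * (2 / (k : ℝ) ^ 2) := by ring
  rw [e6]
  linarith

end Assembly

end MixedRegression

/-! ### Choice of constants and conclusion. -/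

theorem mainTheorem2 (chat : ℝ) (hchat0 : 0 < chat) (hchat : chat < 1 / 2)
    (pmin : ℝ) (hpmin : 0 < pmin) :
    ∃ c₁ c₂ c₃ : ℝ, 0 < c₁ ∧ 0 < c₂ ∧ 0 < c₃ ∧
      ∀ (k : ℕ) (β₁ β₂ : MixedRegression.Vec k), ‖β₁‖ = 1 → ‖β₂‖ = 1 → β₁ ≠ -β₂ →
      ∀ p₁ p₂ : ℝ, p₁ + p₂ = 1 → min p₁ p₂ = pmin →
      ∀ δ : ℝ, 0 < δ → δ ≤ 2 / 11 * chat * ‖β₁ - β₂‖ * Real.sqrt (min p₁ p₂) ^ 3 →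
      ∀ (N : ℕ) (Sstar Splus : Finset (Fin N)),
        Disjoint Sstar Splus → Sstar ∪ Splus = Finset.univ →
        c₁ * (1 / MixedRegression.deltaTilde δ p₁ p₂ β₁ β₂) ^ 2 * k * Real.log k ^ 2
          ≤ (Sstar.card : ℝ) →
        c₂ / min p₁ p₂ * k ≤ (Splus.card : ℝ) →
      ∀ (Ω : Type*) [MeasurableSpace Ω] (μ : MeasureTheory.Measure Ω)
        [MeasureTheory.IsProbabilityMeasure μ]
        (x : Fin N → Ω → MixedRegression.Vec k) (z : Fin N → Ω → Bool),
        MixedRegression.IsMixedDesign μ p₁ x z →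
        ∃ E : Set Ω, MeasurableSet E ∧ 1 - c₃ / (k : ℝ) ^ 2 ≤ μ.real E ∧
          ∀ ω ∈ E, ∀ y : Fin N → ℝ,
            (∀ i, y i = MixedRegression.response β₁ β₂ (x i ω) (z i ω)) →
            (∃ b₁ b₂ : MixedRegression.Vec k,
              MixedRegression.IsInitOutput δ Sstar Splus (fun i => x i ω) y b₁ b₂) ∧
            ∀ b₁ b₂ : MixedRegression.Vec k,
              MixedRegression.IsInitOutput δ Sstar Splus (fun i => x i ω) y b₁ b₂ →
              min (MixedRegression.err β₁ β₂ b₁ b₂) (MixedRegression.err β₁ β₂ b₂ b₁)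
                ≤ chat * min p₁ p₂ * ‖β₁ - β₂‖ := by
  -- Two weights summing to 1 have minimum at most `1/2`, so a larger `pmin` is vacuous.
  obtain hbig | hsmall := lt_or_ge (1 / 2) pmin
  · refine ⟨1, 1, 1, one_pos, one_pos, one_pos, fun k β₁ β₂ _ _ _ p₁ p₂ hp hmin => ?_⟩
    have h1 := min_le_left p₁ p₂
    have h2 := min_le_right p₁ p₂
    linarith
  -- One net serves both events; its mesh is dictated by the lower bound on the class-wise minima.
  set η := Real.sqrt pmin / 50 with hη
  have hη0 : 0 < η := by positivity
  have hηsq : η ^ 2 = pmin / 2500 := by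
    rw [hη, div_pow, Real.sq_sqrt hpmin.le]; norm_num
  have hηle : η ≤ 1 / 8 := by
    refine le_of_sq_le_sq ?_ (by norm_num)
    rw [hηsq]; linarith
  set L := 1 + 2 / η with hL
  have hL1 : 1 ≤ L := by
    have : 0 < 2 / η := by positivity
    linarith
  set R := Real.log L + 1 with hR
  have hR1 : 1 ≤ R := by linarith [Real.log_nonneg hL1]
  refine ⟨10 ^ 7 * R ^ 2 * (40000 / pmin) ^ 2, 150 * R, 12, by positivity, by positivity,
    by norm_num, ?_⟩
  intro k β₁ β₂ hβ₁ hβ₂ hne' p₁ p₂ hp hmin δ hδ hδle N Sstar Splus _ _ hstar hplus Ω _ μ _ x z hd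
  rw [hmin] at hδle hplus ⊢
  have hp₁ : pmin ≤ p₁ := hmin ▸ min_le_left p₁ p₂
  have hp₂ : pmin ≤ p₂ := hmin ▸ min_le_right p₁ p₂
  obtain rfl : p₂ = 1 - p₁ := by linarith
  -- If they coincided, the upper bound on `δ` would be zero.
  have hne : β₁ ≠ β₂ := by
    rintro rfl
    simp at hδle
    linarith
  have hk := MixedRegression.two_le_of_ne hβ₁ hβ₂ hne hne'
  have hk0 : (0 : ℝ) < k := by exact_mod_cast (by omega : 0 < k)
  have hδ1 : δ ≤ 1 := by
    have h1 : ‖β₁ - β₂‖ ≤ 2 := (norm_sub_le _ _).trans (by rw [hβ₁, hβ₂]; norm_num)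
    have h2 : Real.sqrt pmin ≤ 1 := Real.sqrt_le_one.2 (by linarith)
    have h3 : Real.sqrt pmin ^ 3 ≤ 1 := pow_le_one₀ (Real.sqrt_nonneg _) h2
    calc δ ≤ _ := hδle
      _ ≤ 2 / 11 * (1 / 2) * 2 * 1 := by gcongr
      _ ≤ 1 := by norm_num
  obtain ⟨hdt0, hdt⟩ := MixedRegression.deltaTilde_pos_and_le hβ₁ hβ₂ hne hne'
    (hpmin.trans_le hp₁) (hpmin.trans_le hp₂) hδ
  set ε := pmin * δ ^ 2 / 40000 with hε
  have hε0 : 0 < ε := by positivity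
  have hε1 : ε ≤ 1 := by
    have : δ ^ 2 ≤ 1 := pow_le_one₀ hδ.le hδ1
    rw [hε]; nlinarith
  have hstar' : 10 ^ 7 * R ^ 2 * k * Real.log k ^ 2 / ε ^ 2 ≤ (Sstar.card : ℝ) := by
    refine le_trans ?_ hstar
    have h1 : 1 / δ ^ 2 ≤ 1 / MixedRegression.deltaTilde δ p₁ (1 - p₁) β₁ β₂ :=
      one_div_le_one_div_of_le hdt0 hdt
    calc 10 ^ 7 * R ^ 2 * k * Real.log k ^ 2 / ε ^ 2
        = 10 ^ 7 * R ^ 2 * (40000 / pmin) ^ 2 * (1 / δ ^ 2) ^ 2 * k * Real.log k ^ 2 := by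
          rw [hε]; field_simp
      _ ≤ _ := by gcongr
  obtain ⟨T, hT, hTcard, hnet⟩ := MixedRegression.exists_sphere_net k hη0
  obtain ⟨hstar0, G₁, hG₁, hG₁μ, hG₁ω⟩ := hd.exists_event_moment_of_card
    (hpmin.le.trans hp₁) (by linarith) hk hβ₁ hβ₂ Sstar hT hL1 hTcard hR hε0 hε1 hstar'
  obtain ⟨hplus0, G₂, hG₂, hG₂μ, hG₂ω⟩ := hd.exists_event_loss_of_card (by omega) hpmin hp₁ hp₂
    Splus hT hL1 hTcard hR hplus
  refine ⟨G₁ ∩ G₂, hG₁.inter hG₂, ?_, ?_⟩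
  · have h1 : μ.real (G₁ ∩ G₂)ᶜ ≤ μ.real G₁ᶜ + μ.real G₂ᶜ := by
      rw [Set.compl_inter]
      exact MeasureTheory.measureReal_union_le _ _
    rw [MeasureTheory.probReal_compl_eq_one_sub (hG₁.inter hG₂)] at h1
    have e : (12 : ℝ) / (k : ℝ) ^ 2 = 6 / (k : ℝ) ^ 2 + 6 / (k : ℝ) ^ 2 := by ring
    rw [e]
    linarith
  · rintro ω ⟨hω₁, hω₂⟩ y hy
    obtain rfl : y = fun i => MixedRegression.response β₁ β₂ (x i ω) (z i ω) := funext hy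
    refine ⟨MixedRegression.exists_isInitOutput hk δ Sstar Splus _ _, ?_⟩
    rintro b₁ b₂ ⟨v₁, v₂, hv, -, -, hbmin⟩
    obtain ⟨hω₂u, hω₂l⟩ := hG₂ω ω hω₂
    have hform := MixedRegression.momentOp_form_sub_le hstar0 hε0.le hT (by linarith) hnet
      (hG₁ω ω hω₁)
    obtain ⟨⟨u₁, hu₁, hu₁'⟩, u₂, hu₂, hu₂'⟩ := hv.exists_mem_grid_near
      (MixedRegression.isSymmetric_momentOp _ _ _) hpmin hp₁ hp₂ hδ hε hβ₁ hβ₂ hform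
    have hup := MixedRegression.sum_inner_sq_le_of_net hT hηle hnet hω₂u
    exact MixedRegression.min_err_le_of_loss_le hplus0 hpmin hsmall hδ hchat0 hchat hδle hup
      (fun b a a' ha ha' =>
        MixedRegression.sum_min_ge_of_net hηsq hnet hup (hω₂l b) ha ha')
      hu₁' hu₂' (hbmin u₁ hu₁ u₂ hu₂)
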